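/- Work over $\mathbb{C}$. Let $n,k\ge 1$, let $a_0,\dots,a_n$ be positive integers such that $\gcd(a_0,\dots,\widehat{a_i},\dots,a_n)=1$ for every $i$, and let $d_0,\dots,d_n$ be arbitrary integers. *Weighted projective space.* $\mathbb{P}(a_0,\dots,a_n)$ denotes the toric variety of the fan $\Sigma_a$ in the lattice $N_a=\mathbb{Z}^{n+1}/\mathbb{Z}(a_0,\dots,a_n)$ whose cones are spanned by the images of the proper subsets of the standard basis of $\mathbb{Z}^{n+1}$; $\mathbb{P}^k=\mathbb{P}(1,\dots,1)$, with lattice $N_{\mathbb{P}^k}=\mathbb{Z}^{k+1}/\mathbb{Z}(1,\dots,1)$. *The bundle.* Let $N$ be the cokernel of the map $\mathbb{Z}^2\to\mathbb{Z}^{n+1}\oplus\mathbb{Z}^{k+1}$ whose matrix has rows $(a_0,-d_0),\dots,(a_n,-d_n),(0,1),\dots,(0,1)$. With $e_0,\dots,e_n$ and $f_0,\dots,f_k$ the standard bases of $\mathbb{Z}^{n+1}$ and $\mathbb{Z}^{k+1}$, let $\Sigma$ be the fan in $N_{\mathbb{R}}$ consisting of the cones spanned by the images of those subsets of $\{e_0,\dots,e_n,f_0,\dots,f_k\}$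 that contain neither all of the $e_i$ nor all of the $f_j$, and let $X_\Sigma$ be its toric variety. Let $i':N_a\to N$ and $\pi':N\to N_{\mathbb{P}^k}$ be induced by the inclusion of $\mathbb{Z}^{n+1}$ and the projection onto $\mathbb{Z}^{k+1}$. *Locally trivial toric fibration.* Toric varieties $F,X,B$ of fans all of whose maximal cones have dimension equal to the rank of the lattice, together with morphisms $i:F\to X$, $\pi:X\to B$, form a locally trivial toric fibration if $i$ and $\pi$ are induced by maps of fans, $i$ identifies $F$ with the (scheme-theoretic) fiber of $\pi$ over the identity element of the torus of $B$, and for every affine open toric subvariety $U_\tau\subseteq B$ ($\tau$ a cone of the fan of $B$) there is an isomorphism $\pi^{-1}(U_\tau)\cong F\times U_\tau$ over $U_\tau$. **Proposition.** The maps $i'$ and $\pi'$ are maps of fans, and the induced morphisms $$\mathbb{P}(a_0,\dots,a_n)\xrightarrow{\;i\;}X_\Sigma\xrightarrow{\;\pi\;}\mathbb{P}^k$$ form a locally trivial toric fibration over $\mathbb{P}^k$ with fiber $\mathbb{P}(a_0,\dots,a_n)$. Moreover, for $0\le j\le k$ let $U_j\subseteq\mathbb{P}^k$ be the affine chart of the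 cone $\sigma_j$ spanned by the images of all $f_l$ with $l\ne j$. The automorphism $\begin{pmatrix}I_{n+1}&M_j\\0&I_{k+1}\end{pmatrix}$ of $\mathbb{Z}^{n+1}\oplus\mathbb{Z}^{k+1}$, where the only nonzero column of $M_j$ is the one with index $j$, equal to $(d_0,\dots,d_n)^{T}$, induces an isomorphism $\psi_j:N\to N_a\oplus N_{\mathbb{P}^k}$ with second component $\pi'$. It carries the set of cones of $\Sigma$ that lie over $\sigma_j$ onto the set of cones $\kappa\times\rho$ with $\kappa\in\Sigma_a$ and $\rho$ a cone of the fan of $\mathbb{P}^k$ contained in $\sigma_j$, and the toric morphisms it induces on affine charts glue to an isomorphism $\pi^{-1}(U_j)\cong\mathbb{P}(a_0,\dots,a_n)\times U_j$ over $U_j$. -/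

import Mathlib

open CategoryTheory CategoryTheory.Limits AlgebraicGeometry
open scoped TensorProduct

noncomputable section

namespace Toric

/-! ### Cones and fans -/

section Cones

variable {N N' N'' : Type} [AddCommGroup N] [AddCommGroup N'] [AddCommGroup N'']

/-- The real vector space `N_ℝ = ℝ ⊗ N`. -/
abbrev RealSpace (N : Type) [AddCommGroup N] : Type := ℝ ⊗[ℤ] N

/-- The real linear map `φ_ℝ : N_ℝ → N'_ℝ` induced by a homomorphism `φ : N → N'`. -/
def realMap (φ : N →+ N') : RealSpace N →ₗ[ℝ] RealSpace N' :=
  φ.toIntLinearMap.baseChange ℝ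

/-- The value `⟨m, x⟩` of `m ∈ M = Hom(N, ℤ)` at `x ∈ N_ℝ`. -/
def pairing (m : N →+ ℤ) : RealSpace N →ₗ[ℝ] ℝ :=
  ((Int.castAddHom ℝ).comp m).toIntLinearMap.liftBaseChange ℝ

@[simp]
lemma realMap_tmul (φ : N →+ N') (r : ℝ) (v : N) : realMap φ (r ⊗ₜ v) = r ⊗ₜ φ v := by
  simp [realMap]

lemma realMap_id (x : RealSpace N) : realMap (AddMonoidHom.id N) x = x := by
  have : realMap (AddMonoidHom.id N) = LinearMap.id := by ext; simp
  simp [this]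

lemma realMap_comp (ψ : N' →+ N'') (φ : N →+ N') (x : RealSpace N) :
    realMap (ψ.comp φ) x = realMap ψ (realMap φ x) := by
  have : realMap (ψ.comp φ) = (realMap ψ).comp (realMap φ) := by ext; simp
  simp [this]

@[simp]
lemma pairing_tmul (m : N →+ ℤ) (r : ℝ) (v : N) : pairing m (r ⊗ₜ v) = r * (m v : ℝ) := by
  simp [pairing]

@[simp]
lemma pairing_zero : pairing (0 : N →+ ℤ) = 0 := by
  ext; simp

lemma pairing_add (m m' : N →+ ℤ) (x : RealSpace N) :
    pairing (m + m') x = pairing m x + pairing m' x := by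
  have : pairing (m + m') = pairing m + pairing m' := by ext; simp
  simp [this]

lemma pairing_comp (φ : N →+ N') (m : N' →+ ℤ) (x : RealSpace N) :
    pairing (m.comp φ) x = pairing m (realMap φ x) := by
  have : pairing (m.comp φ) = (pairing m).comp (realMap φ) := by ext; simp
  simp [this]

/-- The cone in `N_ℝ` spanned by a set of lattice vectors. -/
def spannedCone (S : Set N) : PointedCone ℝ (RealSpace N) :=
  PointedCone.hull ℝ ((fun v : N => (1 : ℝ) ⊗ₜ[ℤ] v) '' S)

lemma mem_spannedCone {S : Set N} {v : N} (hv : v ∈ S) :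
    (1 : ℝ) ⊗ₜ[ℤ] v ∈ spannedCone S :=
  PointedCone.subset_hull ⟨v, hv, rfl⟩

lemma spannedCone_induction {S : Set N} {p : RealSpace N → Prop}
    (mem : ∀ v ∈ S, p ((1 : ℝ) ⊗ₜ[ℤ] v)) (zero : p 0)
    (add : ∀ x y, x ∈ spannedCone S → y ∈ spannedCone S → p x → p y → p (x + y))
    (smul : ∀ (a : ℝ) x, 0 ≤ a → x ∈ spannedCone S → p x → p (a • x))
    {x : RealSpace N} (hx : x ∈ spannedCone S) : p x := by
  refine Submodule.span_induction (p := fun x _ => p x) ?_ zero (fun x y hx hy => add x y hx hy)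
    (fun a x hx => smul a.1 x a.2 hx) hx
  rintro _ ⟨v, hv, rfl⟩
  exact mem v hv

/-- `τ` is a face of `σ`: `τ = σ ∩ m^⊥` for some lattice functional `m` that is nonnegative
on `σ`. (It is applied to rational polyhedral cones `σ`; all their faces are of this form.) -/
def IsFace (τ σ : PointedCone ℝ (RealSpace N)) : Prop :=
  ∃ m : N →+ ℤ, (∀ x ∈ σ, 0 ≤ pairing m x) ∧ ∀ x, x ∈ τ ↔ x ∈ σ ∧ pairing m x = 0

/-- The linear map `φ_ℝ` sends the cone `σ` into the cone `σ'`. -/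
def MapsInto (φ : N →+ N') (σ : PointedCone ℝ (RealSpace N))
    (σ' : PointedCone ℝ (RealSpace N')) : Prop :=
  ∀ x ∈ σ, realMap φ x ∈ σ'

lemma MapsInto.of_le {σ σ' : PointedCone ℝ (RealSpace N)} (h : σ ≤ σ') :
    MapsInto (AddMonoidHom.id N) σ σ' := fun x hx => by rw [realMap_id]; exact h hx

lemma MapsInto.comp {φ : N →+ N'} {ψ : N' →+ N''} {σ : PointedCone ℝ (RealSpace N)}
    {σ' : PointedCone ℝ (RealSpace N')} {σ'' : PointedCone ℝ (RealSpace N'')}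
    (h' : MapsInto ψ σ' σ'') (h : MapsInto φ σ σ') : MapsInto (ψ.comp φ) σ σ'' := fun x hx => by
  rw [realMap_comp]; exact h' _ (h x hx)

/-- A fan in the lattice `N`: a nonempty finite set of strongly convex rational polyhedral cones
in `N_ℝ`, closed under taking faces, in which any two cones meet in a common face.
(As the zero cone is a face of every strongly convex cone, a nonempty fan contains it; this is
the form in which nonemptiness is stated.) -/
structure Fan (N : Type) [AddCommGroup N] [Module.Free ℤ N] [Module.Finite ℤ N] where
  /-- the cones of the fan -/
  cones : Set (PointedCone ℝ (RealSpace N))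
  finite : cones.Finite
  bot_mem : ⊥ ∈ cones
  rational : ∀ σ ∈ cones, ∃ S : Set N, S.Finite ∧ σ = spannedCone S
  salient : ∀ σ ∈ cones, ∀ x ∈ σ, -x ∈ σ → x = 0
  face_mem : ∀ σ ∈ cones, ∀ τ, IsFace τ σ → τ ∈ cones
  inter_face : ∀ σ ∈ cones, ∀ τ ∈ cones, IsFace (σ ⊓ τ) σ ∧ IsFace (σ ⊓ τ) τ

/-- All maximal cones of the fan have dimension equal to the rank of the lattice. -/
def Fan.IsFull [Module.Free ℤ N] [Module.Finite ℤ N] (F : Fan N) : Prop :=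
  ∀ σ ∈ F.cones, (∀ τ ∈ F.cones, σ ≤ τ → τ = σ) →
    Module.finrank ℝ (Submodule.span ℝ (σ : Set (RealSpace N))) = Module.finrank ℤ N

/-- `φ` is a map of fans: every cone is sent into some cone. -/
def IsFanMap [Module.Free ℤ N] [Module.Finite ℤ N] [Module.Free ℤ N'] [Module.Finite ℤ N']
    (φ : N →+ N') (F : Fan N) (F' : Fan N') : Prop :=
  ∀ σ ∈ F.cones, ∃ σ' ∈ F'.cones, MapsInto φ σ σ'

/-- The product cone `τ × ρ` in `(N × N')_ℝ = N_ℝ × N'_ℝ`. -/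
def prodCone (τ : PointedCone ℝ (RealSpace N)) (ρ : PointedCone ℝ (RealSpace N')) :
    PointedCone ℝ (RealSpace (N × N')) :=
  τ.comap (realMap (AddMonoidHom.fst N N')) ⊓ ρ.comap (realMap (AddMonoidHom.snd N N'))

end Cones

/-! ### Affine toric varieties -/

section Charts

variable {N N' N'' : Type} [AddCommGroup N] [AddCommGroup N'] [AddCommGroup N'']

/-- The semigroup `S_σ = σ^∨ ∩ M`. -/
def dualMonoid (σ : PointedCone ℝ (RealSpace N)) : AddSubmonoid (N →+ ℤ) where
  carrier := {m | ∀ x ∈ σ, 0 ≤ pairing m x}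
  zero_mem' := fun x _ => by simp
  add_mem' := fun {m m'} hm hm' x hx => by
    rw [pairing_add]; exact add_nonneg (hm x hx) (hm' x hx)

/-- The semigroup map `S_σ' → S_σ` given by composition with `φ`. -/
def dualMonoidMap (φ : N →+ N') {σ : PointedCone ℝ (RealSpace N)}
    {σ' : PointedCone ℝ (RealSpace N')} (h : MapsInto φ σ σ') :
    dualMonoid σ' →+ dualMonoid σ where
  toFun m := ⟨m.1.comp φ, fun x hx => by rw [pairing_comp]; exact m.2 _ (h x hx)⟩
  map_zero' := rfl
  map_add' _ _ := rfl

/-- The coordinate ring `ℂ[S_σ]`. -/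
abbrev CoordRing (σ : PointedCone ℝ (RealSpace N)) : Type := AddMonoidAlgebra ℂ (dualMonoid σ)

/-- The affine toric variety `U_σ = Spec ℂ[S_σ]`. -/
abbrev chart (σ : PointedCone ℝ (RealSpace N)) : Scheme.{0} := Spec (CommRingCat.of (CoordRing σ))

/-- The structure morphism `U_σ ⟶ Spec ℂ`. -/
def chartStr (σ : PointedCone ℝ (RealSpace N)) : chart σ ⟶ Spec (CommRingCat.of ℂ) :=
  Spec.map (CommRingCat.ofHom (algebraMap ℂ (CoordRing σ)))

/-- The morphism `U_σ ⟶ U_σ'` induced by a linear map that sends `σ` into `σ'`. -/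
def chartMap (φ : N →+ N') {σ : PointedCone ℝ (RealSpace N)}
    {σ' : PointedCone ℝ (RealSpace N')} (h : MapsInto φ σ σ') : chart σ ⟶ chart σ' :=
  Spec.map (CommRingCat.ofHom (AddMonoidAlgebra.mapDomainRingHom ℂ (dualMonoidMap φ h)))

lemma chartMap_str (φ : N →+ N') {σ : PointedCone ℝ (RealSpace N)}
    {σ' : PointedCone ℝ (RealSpace N')} (h : MapsInto φ σ σ') :
    chartMap φ h ≫ chartStr σ' = chartStr σ := by
  unfold chartMap chartStr
  rw [← Spec.map_comp, ← CommRingCat.ofHom_comp]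
  congr 2
  ext x
  simp

lemma chartMap_congr {φ ψ : N →+ N'} {σ : PointedCone ℝ (RealSpace N)}
    {σ' : PointedCone ℝ (RealSpace N')} (e : φ = ψ) (h : MapsInto φ σ σ') (h' : MapsInto ψ σ σ') :
    chartMap φ h = chartMap ψ h' := by
  subst e; rfl

lemma chartMap_comp (φ : N →+ N') (ψ : N' →+ N'') {σ : PointedCone ℝ (RealSpace N)}
    {σ' : PointedCone ℝ (RealSpace N')} {σ'' : PointedCone ℝ (RealSpace N'')}
    (h : MapsInto φ σ σ') (h' : MapsInto ψ σ' σ'') :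
    chartMap φ h ≫ chartMap ψ h' = chartMap (ψ.comp φ) (h'.comp h) := by
  unfold chartMap
  rw [← Spec.map_comp, ← CommRingCat.ofHom_comp, ← AddMonoidAlgebra.mapDomainRingHom_comp]
  rfl

lemma chartMap_id {σ : PointedCone ℝ (RealSpace N)} (h : MapsInto (AddMonoidHom.id N) σ σ) :
    chartMap (AddMonoidHom.id N) h = 𝟙 (chart σ) := by
  have : dualMonoidMap (AddMonoidHom.id N) h = AddMonoidHom.id _ := rfl
  unfold chartMap
  rw [this, AddMonoidAlgebra.mapDomainRingHom_id]
  exact Spec.map_id _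

/-- For a rational polyhedral cone `σ` and `m ∈ S_σ` with `τ = σ ∩ m^⊥`, the ring `ℂ[S_τ]` is the
localization of `ℂ[S_σ]` at the character of `m`. -/
lemma isLocalization_face {σ τ : PointedCone ℝ (RealSpace N)} {S : Set N} (hS : S.Finite)
    (hσ : σ = spannedCone S) (m : dualMonoid σ)
    (hτ : ∀ x, x ∈ τ ↔ x ∈ σ ∧ pairing m.1 x = 0) (h : MapsInto (AddMonoidHom.id N) τ σ) :
    let _ := (AddMonoidAlgebra.mapDomainRingHom ℂ (dualMonoidMap (AddMonoidHom.id N) h)).toAlgebra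
    IsLocalization.Away (AddMonoidAlgebra.single m (1 : ℂ)) (CoordRing τ) := by
  let _ := (AddMonoidAlgebra.mapDomainRingHom ℂ (dualMonoidMap (AddMonoidHom.id N) h)).toAlgebra
  have halg : ∀ x : CoordRing σ, algebraMap (CoordRing σ) (CoordRing τ) x =
      AddMonoidAlgebra.mapDomain (dualMonoidMap (AddMonoidHom.id N) h) x := fun _ => rfl
  have hinj : Function.Injective (dualMonoidMap (AddMonoidHom.id N) h) := by
    intro x y hxy
    apply Subtype.ext
    have := congrArg Subtype.val hxy
    simpa [dualMonoidMap] using this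
  have hneg : ∀ x ∈ τ, pairing (-m.1) x = 0 := by
    intro x hx
    have h0 := pairing_add m.1 (-m.1) x
    rw [((hτ x).1 hx).2] at h0
    simpa using h0.symm
  let n : dualMonoid τ := ⟨-m.1, fun x hx => (hneg x hx).ge⟩
  have key : ∀ w : dualMonoid τ, ∃ p : ℕ, ∃ u : dualMonoid σ,
      w + p • (dualMonoidMap (AddMonoidHom.id N) h m) = dualMonoidMap (AddMonoidHom.id N) h u := by
    intro w
    have hSσ : ∀ v ∈ S, (1 : ℝ) ⊗ₜ[ℤ] v ∈ σ := fun v hv => by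
      rw [hσ]; exact mem_spannedCone hv
    have hp : ∀ v ∈ S, ∃ p : ℕ, ∀ q : ℕ, p ≤ q → 0 ≤ w.1 v + q * m.1 v := by
      intro v hv
      have h1 := m.2 _ (hSσ v hv)
      rw [pairing_tmul, one_mul] at h1
      have h1 : 0 ≤ m.1 v := by exact_mod_cast h1
      rcases h1.eq_or_lt with h2 | h2
      · have h3 : (1 : ℝ) ⊗ₜ[ℤ] v ∈ τ := (hτ _).2 ⟨hSσ v hv, by simp [← h2]⟩
        have h4 := w.2 _ h3
        rw [pairing_tmul, one_mul] at h4
        have h4 : 0 ≤ w.1 v := by exact_mod_cast h4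
        exact ⟨0, fun q _ => by rw [← h2]; simpa using h4⟩
      · refine ⟨(w.1 v).natAbs, fun q hq => ?_⟩
        have : ((w.1 v).natAbs : ℤ) ≤ q := by exact_mod_cast hq
        nlinarith [neg_abs_le (w.1 v), Int.natCast_natAbs (w.1 v)]
    choose! p hp using hp
    obtain ⟨P, hP⟩ : ∃ P : ℕ, ∀ v ∈ S, p v ≤ P := by
      obtain ⟨P, hP⟩ := (hS.image p).bddAbove
      exact ⟨P, fun v hv => hP ⟨v, hv, rfl⟩⟩
    refine ⟨P, ⟨w.1 + P • m.1, ?_⟩, ?_⟩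
    · intro x hx
      rw [hσ] at hx
      refine spannedCone_induction (p := fun x => 0 ≤ pairing (w.1 + P • m.1) x) ?_ ?_ ?_ ?_ hx
      · intro v hv
        have := hp v hv P (hP v hv)
        simp only [pairing_tmul, one_mul]
        have h5 : (w.1 + P • m.1) v = w.1 v + P * m.1 v := by simp
        rw [h5]; exact_mod_cast this
      · simp
      · intro x y _ _ hx hy; rw [map_add]; exact add_nonneg hx hy
      · intro a x ha _ hx
        rw [map_smul]; exact mul_nonneg ha hx
    · rfl
  refine IsLocalization.Away.mk _ ?_ ?_ ?_
  · rw [halg, AddMonoidAlgebra.mapDomain_single]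
    refine IsUnit.of_mul_eq_one (AddMonoidAlgebra.single n 1) ?_
    rw [AddMonoidAlgebra.single_mul_single, AddMonoidAlgebra.one_def, mul_one]
    congr 1
    apply Subtype.ext
    simp [dualMonoidMap, n]
  · intro f
    induction f using AddMonoidAlgebra.induction_linear with
    | zero => exact ⟨0, 0, by simp⟩
    | add f g hf hg =>
      obtain ⟨p, x, hx⟩ := hf
      obtain ⟨q, y, hy⟩ := hg
      refine ⟨p + q, x * (AddMonoidAlgebra.single m 1) ^ q + y * (AddMonoidAlgebra.single m 1) ^ p, ?_⟩
      rw [map_add, map_mul, map_mul, map_pow, map_pow, ← hx, ← hy]; ring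
    | single w c =>
      obtain ⟨p, u, hu⟩ := key w
      refine ⟨p, AddMonoidAlgebra.single u c, ?_⟩
      rw [halg, halg, AddMonoidAlgebra.mapDomain_single, AddMonoidAlgebra.mapDomain_single,
        AddMonoidAlgebra.single_pow, AddMonoidAlgebra.single_mul_single, hu]
      simp
  · intro x y hxy
    refine ⟨0, ?_⟩
    have := AddMonoidAlgebra.mapDomain_injective hinj (R := ℂ) hxy
    rw [this]

lemma isOpenImmersion_face {σ τ : PointedCone ℝ (RealSpace N)} {S : Set N} (hS : S.Finite)
    (hσ : σ = spannedCone S) (hf : IsFace τ σ) (h : MapsInto (AddMonoidHom.id N) τ σ) :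
    IsOpenImmersion (chartMap (AddMonoidHom.id N) h) := by
  obtain ⟨m, hm, hτ⟩ := hf
  let _ := (AddMonoidAlgebra.mapDomainRingHom ℂ (dualMonoidMap (AddMonoidHom.id N) h)).toAlgebra
  have := isLocalization_face hS hσ ⟨m, hm⟩ hτ h
  exact IsOpenImmersion.of_isLocalization (S := CoordRing τ)
    (AddMonoidAlgebra.single (⟨m, hm⟩ : dualMonoid σ) (1 : ℂ))

lemma range_face {σ τ : PointedCone ℝ (RealSpace N)} {S : Set N} (hS : S.Finite)
    (hσ : σ = spannedCone S) (m : dualMonoid σ)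
    (hτ : ∀ x, x ∈ τ ↔ x ∈ σ ∧ pairing m.1 x = 0) (h : MapsInto (AddMonoidHom.id N) τ σ) :
    Set.range (chartMap (AddMonoidHom.id N) h) =
      (PrimeSpectrum.basicOpen (AddMonoidAlgebra.single m (1 : ℂ)) :
        Set (PrimeSpectrum (CoordRing σ))) := by
  let _ := (AddMonoidAlgebra.mapDomainRingHom ℂ (dualMonoidMap (AddMonoidHom.id N) h)).toAlgebra
  have := isLocalization_face hS hσ m hτ h
  exact PrimeSpectrum.localization_away_comap_range (CoordRing τ)
    (AddMonoidAlgebra.single m (1 : ℂ))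

lemma exists_of_faces {ρ σ τ : PointedCone ℝ (RealSpace N)} {S : Set N} (hS : S.Finite)
    (hρ : ρ = spannedCone S) (hfσ : IsFace σ ρ) (hfτ : IsFace τ ρ)
    (hσ : MapsInto (AddMonoidHom.id N) σ ρ) (hτ : MapsInto (AddMonoidHom.id N) τ ρ)
    (hl : MapsInto (AddMonoidHom.id N) (σ ⊓ τ) σ) (hr : MapsInto (AddMonoidHom.id N) (σ ⊓ τ) τ)
    (x : chart σ) (y : chart τ)
    (hxy : chartMap (AddMonoidHom.id N) hσ x = chartMap (AddMonoidHom.id N) hτ y) :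
    ∃ z : chart (σ ⊓ τ), chartMap (AddMonoidHom.id N) hl z = x ∧
      chartMap (AddMonoidHom.id N) hr z = y := by
  have := isOpenImmersion_face hS hρ hfσ hσ
  have := isOpenImmersion_face hS hρ hfτ hτ
  obtain ⟨m, hm, hmσ⟩ := hfσ
  obtain ⟨m', hm', hmτ⟩ := hfτ
  have hmm : ∀ z, z ∈ σ ⊓ τ ↔ z ∈ ρ ∧ pairing (m + m') z = 0 := by
    intro z
    rw [Submodule.mem_inf, hmσ, hmτ, pairing_add]
    constructor
    · rintro ⟨⟨h1, h2⟩, -, h3⟩; exact ⟨h1, by rw [h2, h3, add_zero]⟩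
    · rintro ⟨h1, h2⟩
      have := hm z h1
      have := hm' z h1
      exact ⟨⟨h1, by linarith⟩, h1, by linarith⟩
  have hlσ : MapsInto (AddMonoidHom.id N) (σ ⊓ τ) ρ := fun z hz => by
    rw [realMap_id]; exact ((hmm z).1 hz).1
  have c1 : chartMap (AddMonoidHom.id N) hl ≫ chartMap (AddMonoidHom.id N) hσ =
      chartMap (AddMonoidHom.id N) hlσ :=
    (chartMap_comp _ _ _ _).trans (chartMap_congr (AddMonoidHom.comp_id _) _ _)
  have c2 : chartMap (AddMonoidHom.id N) hr ≫ chartMap (AddMonoidHom.id N) hτ =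
      chartMap (AddMonoidHom.id N) hlσ :=
    (chartMap_comp _ _ _ _).trans (chartMap_congr (AddMonoidHom.comp_id _) _ _)
  have e1 := range_face hS hρ ⟨m, hm⟩ hmσ hσ
  have e2 := range_face hS hρ ⟨m', hm'⟩ hmτ hτ
  have e3 := range_face hS hρ ⟨m + m', (dualMonoid ρ).add_mem hm hm'⟩ hmm hlσ
  have hprod : (AddMonoidAlgebra.single ⟨m + m', (dualMonoid ρ).add_mem hm hm'⟩ 1 : CoordRing ρ) =
      AddMonoidAlgebra.single ⟨m, hm⟩ 1 * AddMonoidAlgebra.single ⟨m', hm'⟩ 1 := by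
    rw [AddMonoidAlgebra.single_mul_single, mul_one]
    rfl
  rw [hprod, PrimeSpectrum.basicOpen_mul, TopologicalSpace.Opens.coe_inf, ← e1, ← e2] at e3
  have hx : chartMap (AddMonoidHom.id N) hσ x ∈ Set.range (chartMap (AddMonoidHom.id N) hlσ) := by
    rw [e3]
    exact ⟨⟨x, rfl⟩, ⟨y, hxy.symm⟩⟩
  obtain ⟨z, hz⟩ := hx
  refine ⟨z, ?_, ?_⟩
  · apply (chartMap (AddMonoidHom.id N) hσ).isOpenEmbedding.injective
    rw [← hz, ← c1, Scheme.Hom.comp_apply]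
  · apply (chartMap (AddMonoidHom.id N) hτ).isOpenEmbedding.injective
    rw [← hxy, ← hz, ← c2, Scheme.Hom.comp_apply]

end Charts

/-! ### Toric varieties -/

namespace Fan

variable {N N' : Type} [AddCommGroup N] [AddCommGroup N']
  [Module.Free ℤ N] [Module.Finite ℤ N] [Module.Free ℤ N'] [Module.Finite ℤ N']

lemma isFace_of_le (F : Fan N) {τ σ : PointedCone ℝ (RealSpace N)} (hτ : τ ∈ F.cones)
    (hσ : σ ∈ F.cones) (h : τ ≤ σ) : IsFace τ σ := by
  have := (F.inter_face σ hσ τ hτ).1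
  rwa [inf_eq_right.2 h] at this

lemma inf_mem (F : Fan N) {τ σ : PointedCone ℝ (RealSpace N)} (hτ : τ ∈ F.cones)
    (hσ : σ ∈ F.cones) : τ ⊓ σ ∈ F.cones :=
  F.face_mem _ hτ _ (F.inter_face τ hτ σ hσ).1

/-- The cones of a fan, ordered by inclusion. -/
abbrev Index (F : Fan N) : Type := {σ : PointedCone ℝ (RealSpace N) // σ ∈ F.cones}

/-- The diagram of affine toric varieties `U_σ`, `σ ∈ Σ`, and the inclusions `U_τ ⊆ U_σ` for
`τ ⊆ σ`. -/
def diagram (F : Fan N) : F.Index ⥤ Scheme.{0} where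
  obj σ := chart σ.1
  map f := chartMap (AddMonoidHom.id N) (MapsInto.of_le (leOfHom f))
  map_id _ := chartMap_id _
  map_comp f g := by
    rw [chartMap_comp]
    exact chartMap_congr (AddMonoidHom.comp_id _).symm _ _

instance (F : Fan N) {σ τ : F.Index} (f : σ ⟶ τ) : IsOpenImmersion (F.diagram.map f) := by
  obtain ⟨S, hS, h⟩ := F.rational _ τ.2
  exact isOpenImmersion_face hS h (F.isFace_of_le σ.2 τ.2 (leOfHom f)) _

instance (F : Fan N) : (F.diagram ⋙ Scheme.forget).IsLocallyDirected where
  cond := by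
    intro i j k f g x y hxy
    obtain ⟨S, hS, hSk⟩ := F.rational _ k.2
    let l : F.Index := ⟨i.1 ⊓ j.1, F.inf_mem i.2 j.2⟩
    let fl : l ⟶ i := homOfLE (show i.1 ⊓ j.1 ≤ i.1 from inf_le_left)
    let gl : l ⟶ j := homOfLE (show i.1 ⊓ j.1 ≤ j.1 from inf_le_right)
    obtain ⟨z, h1, h2⟩ := exists_of_faces hS hSk (F.isFace_of_le i.2 k.2 (leOfHom f))
      (F.isFace_of_le j.2 k.2 (leOfHom g)) (MapsInto.of_le (leOfHom f))
      (MapsInto.of_le (leOfHom g)) (MapsInto.of_le (leOfHom fl)) (MapsInto.of_le (leOfHom gl))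
      x y hxy
    exact ⟨l, fl, gl, z, h1, h2⟩

/-- The toric variety `X_Σ` over `ℂ`, obtained by gluing the affine toric varieties `U_σ`,
`σ ∈ Σ`, along the open immersions `U_τ ⟶ U_σ` for faces `τ` of `σ`. -/
def toricVariety (F : Fan N) : Scheme.{0} := colimit F.diagram

/-- The inclusion `U_σ ⟶ X_Σ` of an affine open toric subvariety. -/
def ι (F : Fan N) {σ : PointedCone ℝ (RealSpace N)} (hσ : σ ∈ F.cones) :
    chart σ ⟶ F.toricVariety := colimit.ι F.diagram ⟨σ, hσ⟩

instance (F : Fan N) {σ : PointedCone ℝ (RealSpace N)} (hσ : σ ∈ F.cones) :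
    IsOpenImmersion (F.ι hσ) :=
  inferInstanceAs (IsOpenImmersion (colimit.ι F.diagram ⟨σ, hσ⟩))

lemma chartMap_ι (F : Fan N) {τ σ : PointedCone ℝ (RealSpace N)} (hτ : τ ∈ F.cones)
    (hσ : σ ∈ F.cones) (h : MapsInto (AddMonoidHom.id N) τ σ) :
    chartMap (AddMonoidHom.id N) h ≫ F.ι hσ = F.ι hτ := by
  have hle : τ ≤ σ := fun x hx => by simpa [realMap_id] using h x hx
  exact colimit.w F.diagram (homOfLE hle : (⟨τ, hτ⟩ : F.Index) ⟶ ⟨σ, hσ⟩)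

lemma hom_ext (F : Fan N) {Y : Scheme.{0}} {f g : F.toricVariety ⟶ Y}
    (h : ∀ σ (hσ : σ ∈ F.cones), F.ι hσ ≫ f = F.ι hσ ≫ g) : f = g :=
  colimit.hom_ext fun σ => h σ.1 σ.2

/-- The structure morphism `X_Σ ⟶ Spec ℂ`. -/
def str (F : Fan N) : F.toricVariety ⟶ Spec (CommRingCat.of ℂ) :=
  colimit.desc F.diagram
    { pt := _
      ι := { app := fun σ => chartStr σ.1
             naturality := fun _ _ _ => (chartMap_str _ _).trans (Category.comp_id _).symm } }

lemma ι_str (F : Fan N) {σ : PointedCone ℝ (RealSpace N)} (hσ : σ ∈ F.cones) :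
    F.ι hσ ≫ F.str = chartStr σ :=
  colimit.ι_desc _ _

/-- The identity element of the torus `Spec ℂ[M] = U_0 ⊆ X_Σ`: the `ℂ`-point at which every
character takes the value `1`. -/
def onePoint (F : Fan N) : Spec (CommRingCat.of ℂ) ⟶ F.toricVariety :=
  Spec.map (CommRingCat.ofHom (AddMonoidAlgebra.lift ℂ ℂ
    (dualMonoid (⊥ : PointedCone ℝ (RealSpace N))) 1).toRingHom) ≫ F.ι F.bot_mem

lemma map_aux {N : Type} [AddCommGroup N] {φ : N →+ N'} {F' : Fan N'} {τ σ : PointedCone ℝ (RealSpace N)}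
    {τ' σ' : PointedCone ℝ (RealSpace N')} (hle : MapsInto (AddMonoidHom.id N) τ σ)
    (hτ' : τ' ∈ F'.cones) (hσ' : σ' ∈ F'.cones) (h : MapsInto φ τ τ') (h' : MapsInto φ σ σ') :
    chartMap (AddMonoidHom.id N) hle ≫ chartMap φ h' ≫ F'.ι hσ' = chartMap φ h ≫ F'.ι hτ' := by
  have hm := F'.inf_mem hτ' hσ'
  have h1 : MapsInto φ τ (τ' ⊓ σ') := fun x hx =>
    ⟨h x hx, by simpa [realMap_id] using h' _ (hle x hx)⟩
  trans chartMap φ h1 ≫ F'.ι hm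
  · rw [← F'.chartMap_ι hm hσ' (MapsInto.of_le inf_le_right), ← Category.assoc (chartMap φ h1),
      ← Category.assoc (chartMap _ hle), chartMap_comp, chartMap_comp]
    exact congrArg (· ≫ _) (chartMap_congr (by ext; rfl) _ _)
  · rw [← F'.chartMap_ι hm hτ' (MapsInto.of_le inf_le_left), ← Category.assoc (chartMap φ h1),
      chartMap_comp]
    exact congrArg (· ≫ _) (chartMap_congr (by ext; rfl) _ _)

/-- The toric morphism `X_Σ ⟶ X_Σ'` induced by a map of fans `φ`: on `U_σ` it is the composite
`U_σ ⟶ U_σ' ⊆ X_Σ'` for any cone `σ' ∈ Σ'` that contains `φ_ℝ(σ)`. -/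
def toricMap {φ : N →+ N'} {F : Fan N} {F' : Fan N'} (h : IsFanMap φ F F') :
    F.toricVariety ⟶ F'.toricVariety :=
  colimit.desc F.diagram
    { pt := _
      ι := { app := fun σ => chartMap φ (h σ.1 σ.2).choose_spec.2 ≫
                F'.ι (h σ.1 σ.2).choose_spec.1
             naturality := fun _ _ _ =>
              (map_aux _ _ _ _ _).trans (Category.comp_id _).symm } }

lemma ι_toricMap {φ : N →+ N'} {F : Fan N} {F' : Fan N'} (h : IsFanMap φ F F')
    {σ : PointedCone ℝ (RealSpace N)} {σ' : PointedCone ℝ (RealSpace N')}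
    (hσ : σ ∈ F.cones) (hσ' : σ' ∈ F'.cones) (hφ : MapsInto φ σ σ') :
    F.ι hσ ≫ toricMap h = chartMap φ hφ ≫ F'.ι hσ' := by
  refine (colimit.ι_desc _ _).trans ?_
  have := map_aux (F' := F') (MapsInto.of_le (le_refl σ)) (h σ hσ).choose_spec.1 hσ'
    (h σ hσ).choose_spec.2 hφ
  rw [chartMap_id, Category.id_comp] at this
  exact this.symm

end Fan

/-- `F ⟶ X ⟶ B` is a locally trivial toric fibration: `F`, `X`, `B` are the toric varieties of
fans `FF`, `FX`, `FB` (with full-dimensional maximal cones), the maps `F ⟶ X ⟶ B` are induced by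
maps of fans `i'` and `π'`, `F` is the fiber of `π` over the identity element of the torus of `B`,
and over every affine open toric subvariety `U_τ` of `B` there is an isomorphism
`π⁻¹(U_τ) = X ×_B U_τ ≅ F × U_τ` over `U_τ`. -/
structure IsLocallyTrivialToricFibration {NF NX NB : Type}
    [AddCommGroup NF] [Module.Free ℤ NF] [Module.Finite ℤ NF]
    [AddCommGroup NX] [Module.Free ℤ NX] [Module.Finite ℤ NX]
    [AddCommGroup NB] [Module.Free ℤ NB] [Module.Finite ℤ NB]
    (FF : Fan NF) (FX : Fan NX) (FB : Fan NB) (i' : NF →+ NX) (π' : NX →+ NB) : Prop where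
  full_fiber : FF.IsFull
  full_total : FX.IsFull
  full_base : FB.IsFull
  fanMap_incl : IsFanMap i' FF FX
  fanMap_proj : IsFanMap π' FX FB
  isFiber : IsPullback (Fan.toricMap fanMap_incl) FF.str (Fan.toricMap fanMap_proj) FB.onePoint
  locallyTrivial : ∀ τ (hτ : τ ∈ FB.cones),
    ∃ e : pullback (Fan.toricMap fanMap_proj) (FB.ι hτ) ≅ pullback FF.str (chartStr τ),
      e.hom ≫ pullback.snd FF.str (chartStr τ) =
        pullback.snd (Fan.toricMap fanMap_proj) (FB.ι hτ)

/-- The lattice isomorphism `ψ : N_X ≅ N_F × N_B` induces a trivialization of the toric map given by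
`π'` over the affine open toric subvariety `U_τ` of `B`: the second component of `ψ` is `π'`; `ψ`
carries the cones of `X` that lie over `τ` (the fan of `π⁻¹(U_τ)`) onto the product cones
`κ × ρ`, `κ ∈ FF`, `ρ ∈ FB`, `ρ ⊆ τ` (the fan of `F × U_τ`); and there is an isomorphism
`π⁻¹(U_τ) ≅ F × U_τ` over `U_τ` whose first component is, on each `U_σ ⊆ π⁻¹(U_τ)`, the toric
morphism `U_σ ⟶ U_κ ⊆ F` induced by the first component of `ψ`. -/
structure IsToricTrivialization {NF NX NB : Type}
    [AddCommGroup NF] [Module.Free ℤ NF] [Module.Finite ℤ NF]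
    [AddCommGroup NX] [Module.Free ℤ NX] [Module.Finite ℤ NX]
    [AddCommGroup NB] [Module.Free ℤ NB] [Module.Finite ℤ NB]
    (FF : Fan NF) (FX : Fan NX) (FB : Fan NB) (π' : NX →+ NB) (hπ : IsFanMap π' FX FB)
    {τ : PointedCone ℝ (RealSpace NB)} (hτ : τ ∈ FB.cones) (ψ : NX ≃+ NF × NB) : Prop where
  snd_eq : (AddMonoidHom.snd NF NB).comp ψ.toAddMonoidHom = π'
  cones_eq : PointedCone.map (realMap ψ.toAddMonoidHom) ''
      {σ | σ ∈ FX.cones ∧ MapsInto π' σ τ} =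
    {θ | ∃ κ ∈ FF.cones, ∃ ρ ∈ FB.cones, ρ ≤ τ ∧ θ = prodCone κ ρ}
  exists_iso : ∃ e : pullback (Fan.toricMap hπ) (FB.ι hτ) ≅ pullback FF.str (chartStr τ),
    e.hom ≫ pullback.snd FF.str (chartStr τ) = pullback.snd (Fan.toricMap hπ) (FB.ι hτ) ∧
    ∀ σ (hσ : σ ∈ FX.cones) (hστ : MapsInto π' σ τ) κ (hκ : κ ∈ FF.cones)
      (hσκ : MapsInto ((AddMonoidHom.fst NF NB).comp ψ.toAddMonoidHom) σ κ),
      pullback.lift (FX.ι hσ) (chartMap π' hστ) (Fan.ι_toricMap hπ hσ hτ hστ) ≫ e.hom ≫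
          pullback.fst FF.str (chartStr τ) =
        chartMap ((AddMonoidHom.fst NF NB).comp ψ.toAddMonoidHom) hσκ ≫ FF.ι hκ

/-! ### Fans spanned by the faces of a simplicial complex -/

section Complex

variable {N : Type} [AddCommGroup N] {I : Type}

lemma spannedCone_mono {S T : Set N} (h : S ⊆ T) : spannedCone S ≤ spannedCone T :=
  Submodule.span_mono (Set.image_mono h)

lemma spannedCone_face {v : I → N} {S : Set I} {m : N →+ ℤ} (hm : ∀ i ∈ S, 0 ≤ m (v i))
    {x : RealSpace N} (hx : x ∈ spannedCone (v '' S)) :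
    0 ≤ pairing m x ∧ (pairing m x = 0 → x ∈ spannedCone (v '' {i | i ∈ S ∧ m (v i) = 0})) := by
  refine spannedCone_induction (p := fun x => 0 ≤ pairing m x ∧
    (pairing m x = 0 → x ∈ spannedCone (v '' {i | i ∈ S ∧ m (v i) = 0}))) ?_ ?_ ?_ ?_ hx
  · rintro _ ⟨i, hi, rfl⟩
    simp only [pairing_tmul, one_mul]
    refine ⟨by exact_mod_cast hm i hi, fun h => mem_spannedCone ⟨i, ⟨hi, ?_⟩, rfl⟩⟩
    exact_mod_cast h
  · simp
  · rintro x y - - ⟨hx, hx'⟩ ⟨hy, hy'⟩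
    rw [map_add]
    refine ⟨add_nonneg hx hy, fun h => ?_⟩
    exact add_mem (hx' (by linarith)) (hy' (by linarith))
  · rintro a x ha - ⟨hx, hx'⟩
    rw [map_smul, smul_eq_mul]
    refine ⟨mul_nonneg ha hx, fun h => ?_⟩
    rcases mul_eq_zero.1 h with rfl | h
    · simp
    · exact Submodule.smul_mem _ (⟨a, ha⟩ : {c : ℝ // 0 ≤ c}) (hx' h)

lemma spannedCone_face_iff {v : I → N} {S : Set I} {m : N →+ ℤ} (hm : ∀ i ∈ S, 0 ≤ m (v i))
    (x : RealSpace N) : x ∈ spannedCone (v '' {i | i ∈ S ∧ m (v i) = 0}) ↔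
      x ∈ spannedCone (v '' S) ∧ pairing m x = 0 := by
  constructor
  · intro h
    refine ⟨spannedCone_mono (Set.image_mono fun i hi => hi.1) h, ?_⟩
    have h1 := (spannedCone_face (m := m) (S := {i | i ∈ S ∧ m (v i) = 0})
      (fun i hi => hi.2.ge) h).1
    have h2 := (spannedCone_face (m := -m) (S := {i | i ∈ S ∧ m (v i) = 0})
      (fun i hi => by simp [hi.2]) h).1
    have h3 := pairing_add m (-m) x
    simp only [add_neg_cancel, pairing_zero, LinearMap.zero_apply] at h3
    linarith
  · rintro ⟨h, h'⟩
    exact (spannedCone_face hm h).2 h'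

/-- The fan of the cones spanned by `v i`, `i ∈ S`, where `S` runs through a simplicial complex
`Δ`, provided that any two of these cones can be separated by a lattice functional. -/
def complexFan [Module.Free ℤ N] [Module.Finite ℤ N] [Finite I] (v : I → N) (Δ : Set (Set I))
    (hempty : ∅ ∈ Δ) (hdown : ∀ S ∈ Δ, ∀ T ⊆ S, T ∈ Δ)
    (hsep : ∀ S ∈ Δ, ∀ T ∈ Δ, ∃ m : N →+ ℤ, (∀ i ∈ S, i ∉ T → 0 < m (v i)) ∧
      (∀ i ∈ T, i ∉ S → m (v i) < 0) ∧ ∀ i ∈ S, i ∈ T → m (v i) = 0) : Fan N where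
  cones := {σ | ∃ S ∈ Δ, σ = spannedCone (v '' S)}
  finite := by
    refine (Set.toFinite (Set.range fun S : Set I => spannedCone (v '' S))).subset ?_
    rintro _ ⟨S, -, rfl⟩
    exact ⟨S, rfl⟩
  bot_mem := ⟨∅, hempty, by simp [spannedCone]⟩
  rational := by
    rintro _ ⟨S, -, rfl⟩
    exact ⟨v '' S, Set.toFinite _, rfl⟩
  salient := by
    rintro _ ⟨S, hS, rfl⟩ x hx hx'
    obtain ⟨m, h1, -, -⟩ := hsep S hS ∅ hempty
    have h0 : ∀ i ∈ S, 0 ≤ m (v i) := fun i hi => (h1 i hi (by simp)).le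
    have h2 := spannedCone_face h0 hx
    have h3 := (spannedCone_face h0 hx').1
    rw [map_neg] at h3
    have h4 := h2.2 (by linarith)
    have h5 : {i | i ∈ S ∧ m (v i) = 0} = ∅ := by
      ext i
      simp only [Set.mem_ofPred_eq, Set.mem_empty_iff_false, iff_false, not_and]
      exact fun hi => (h1 i hi (by simp)).ne'
    rw [h5] at h4
    simpa [spannedCone] using h4
  face_mem := by
    rintro _ ⟨S, hS, rfl⟩ τ ⟨m, hm, hτ⟩
    have h0 : ∀ i ∈ S, 0 ≤ m (v i) := fun i hi => by
      have := hm _ (mem_spannedCone ⟨i, hi, rfl⟩)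
      rw [pairing_tmul, one_mul] at this
      exact_mod_cast this
    refine ⟨{i | i ∈ S ∧ m (v i) = 0}, hdown S hS _ fun i hi => hi.1, ?_⟩
    ext x
    rw [hτ, spannedCone_face_iff h0]
  inter_face := by
    have key : ∀ S ∈ Δ, ∀ T ∈ Δ, IsFace (spannedCone (v '' S) ⊓ spannedCone (v '' T))
        (spannedCone (v '' S)) := by
      intro S hS T hT
      obtain ⟨m, h1, h2, h3⟩ := hsep S hS T hT
      have hS0 : ∀ i ∈ S, 0 ≤ m (v i) := fun i hi => by
        by_cases hiT : i ∈ T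
        · exact (h3 i hi hiT).ge
        · exact (h1 i hi hiT).le
      have hT0 : ∀ i ∈ T, 0 ≤ (-m) (v i) := fun i hi => by
        by_cases hiS : i ∈ S
        · simp [h3 i hiS hi]
        · simpa using (h2 i hi hiS).le
      refine ⟨m, fun x hx => (spannedCone_face hS0 hx).1, fun x => ⟨?_, ?_⟩⟩
      · rintro ⟨hx, hx'⟩
        refine ⟨hx, ?_⟩
        have h4 := (spannedCone_face hS0 hx).1
        have h5 := (spannedCone_face hT0 hx').1
        have h6 := pairing_add m (-m) x
        simp only [add_neg_cancel, pairing_zero, LinearMap.zero_apply] at h6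
        linarith
      · rintro ⟨hx, hx'⟩
        refine ⟨hx, spannedCone_mono (Set.image_mono ?_) ((spannedCone_face hS0 hx).2 hx')⟩
        rintro i ⟨hi, hi'⟩
        by_contra hiT
        exact (h1 i hi hiT).ne' hi'
    rintro _ ⟨S, hS, rfl⟩ _ ⟨T, hT, rfl⟩
    exact ⟨key S hS T hT, by rw [inf_comm]; exact key T hT S hS⟩

lemma exists_signs {I : Type} [Fintype I] {S T : Set I} (hS : S ≠ Set.univ) (hT : T ≠ Set.univ)
    (c : ℤ) : ∃ z : I → ℤ, (∀ i ∈ S, i ∉ T → 0 < z i) ∧ (∀ i ∈ T, i ∉ S → z i < 0) ∧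
      (∀ i ∈ S, i ∈ T → z i = 0) ∧ ∑ i, z i = c := by
  classical
  obtain ⟨p, hp⟩ := (Set.ne_univ_iff_exists_notMem S).1 hS
  obtain ⟨q, hq⟩ := (Set.ne_univ_iff_exists_notMem T).1 hT
  let y : I → ℤ := fun i => (if i ∈ S then 1 else 0) - (if i ∈ T then 1 else 0)
  let t := c - ∑ i, y i
  by_cases ht : 0 ≤ t
  · refine ⟨y + Pi.single q t, ?_, ?_, ?_, ?_⟩
    · intro i hi hi'
      by_cases h : i = q
      · subst h; simp [y, hi, hi']; omega
      · simp [y, hi, hi', h]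
    · intro i hi hi'
      have h : i ≠ q := fun h => hq (h ▸ hi)
      simp [y, hi, hi', h]
    · intro i hi hi'
      have h : i ≠ q := fun h => hq (h ▸ hi')
      simp [y, hi, hi', h]
    · simp [Finset.sum_add_distrib, t]
  · refine ⟨y + Pi.single p t, ?_, ?_, ?_, ?_⟩
    · intro i hi hi'
      have h : i ≠ p := fun h => hp (h ▸ hi)
      simp [y, hi, hi', h]
    · intro i hi hi'
      by_cases h : i = p
      · subst h; simp [y, hi, hi']; omega
      · simp [y, hi, hi', h]
    · intro i hi hi'
      have h : i ≠ p := fun h => hp (h ▸ hi)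
      simp [y, hi, hi', h]
    · simp [Finset.sum_add_distrib, t]

end Complex

/-! ### Weighted projective spaces -/

/-- Weights `(a_0, …, a_n)`: positive integers any `n` of which have greatest common divisor `1`. -/
structure Weights (n : ℕ) where
  /-- the weights -/
  a : Fin (n + 1) → ℕ
  pos : ∀ i, 0 < a i
  gcd_eq_one : ∀ i, (Finset.univ.erase i).gcd a = 1

/-- The weights `(1, …, 1)` of the projective space `ℙ^k`. -/
def Weights.one (k : ℕ) (hk : 0 < k) : Weights k where
  a := fun _ => 1
  pos := fun _ => one_pos
  gcd_eq_one := fun i => by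
    have : Nontrivial (Fin (k + 1)) := Fin.nontrivial_iff_two_le.2 (by omega)
    obtain ⟨j, hj⟩ := exists_ne i
    exact Nat.dvd_one.1 (Finset.gcd_dvd (f := fun _ => 1) (b := j) (by simp [hj]))

variable {n : ℕ}

/-- The lattice `N = ℤ^{n+1} / ℤ (a_0, …, a_n)` of `ℙ(a_0, …, a_n)`. -/
def wpsLattice (w : Weights n) : Type :=
  (Fin (n + 1) → ℤ) ⧸ AddSubgroup.zmultiples (fun i => (w.a i : ℤ))

instance (w : Weights n) : AddCommGroup (wpsLattice w) :=
  inferInstanceAs (AddCommGroup ((Fin (n + 1) → ℤ) ⧸ AddSubgroup.zmultiples _))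

/-- The quotient map `ℤ^{n+1} → N`. -/
def wpsMk (w : Weights n) : (Fin (n + 1) → ℤ) →+ wpsLattice w :=
  QuotientAddGroup.mk' (AddSubgroup.zmultiples (fun i => (w.a i : ℤ)))

lemma wpsMk_surjective (w : Weights n) : Function.Surjective (wpsMk w) :=
  QuotientAddGroup.mk'_surjective _

lemma wpsMk_eq_zero (w : Weights n) (x : Fin (n + 1) → ℤ) :
    wpsMk w x = 0 ↔ ∃ c : ℤ, ∀ i, x i = c * w.a i := by
  refine (QuotientAddGroup.eq_zero_iff x).trans ?_
  rw [AddSubgroup.mem_zmultiples_iff]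
  refine exists_congr fun c => ?_
  rw [funext_iff]
  exact forall_congr' fun i => by simp [eq_comm]

lemma Weights.dvd_of_forall_dvd (w : Weights n) {p c : ℤ} (h : ∀ i, p ∣ c * w.a i) : p ∣ c := by
  have h1 : p.natAbs ∣ Finset.univ.gcd fun i => c.natAbs * w.a i :=
    Finset.dvd_gcd fun i _ => by
      simpa [Int.natAbs_mul] using Int.natAbs_dvd_natAbs.2 (h i)
  have h2 : Finset.univ.gcd w.a = 1 :=
    Nat.dvd_one.1 ((Finset.gcd_mono (Finset.erase_subset 0 _)).trans (w.gcd_eq_one 0).dvd)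
  rw [Finset.gcd_mul_left, h2] at h1
  simpa [Int.natAbs_dvd_natAbs] using h1

lemma free_of_torsionFree (N : Type) [AddCommGroup N] [Module.Finite ℤ N]
    (h : ∀ (p : ℤ) (x : N), p ≠ 0 → p • x = 0 → x = 0) : Module.Free ℤ N := by
  have : Module.IsTorsionFree ℤ N := ⟨fun p hp x y hxy => by
    refine sub_eq_zero.1 (h p _ hp.ne_zero ?_)
    rw [smul_sub, sub_eq_zero]
    exact hxy⟩
  infer_instance

instance (w : Weights n) : Module.Finite ℤ (wpsLattice w) :=
  Module.Finite.of_surjective (wpsMk w).toIntLinearMap (wpsMk_surjective w)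

instance (w : Weights n) : Module.Free ℤ (wpsLattice w) := by
  refine free_of_torsionFree _ fun p x hp hx => ?_
  obtain ⟨x, rfl⟩ := wpsMk_surjective w x
  rw [← map_zsmul, wpsMk_eq_zero] at hx
  obtain ⟨c, hc⟩ := hx
  obtain ⟨b, rfl⟩ := w.dvd_of_forall_dvd (p := p) (c := c) fun i => ⟨x i, (hc i).symm⟩
  rw [wpsMk_eq_zero]
  refine ⟨b, fun i => mul_left_cancel₀ hp ?_⟩
  rw [← mul_assoc]
  exact hc i

/-- The image in `N` of the `i`-th standard basis vector of `ℤ^{n+1}`. -/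
def wpsVec (w : Weights n) (i : Fin (n + 1)) : wpsLattice w := wpsMk w (Pi.single i 1)

/-- The cone spanned by the images of the standard basis vectors with index in `S`. -/
def wpsCone (w : Weights n) (S : Set (Fin (n + 1))) : PointedCone ℝ (RealSpace (wpsLattice w)) :=
  spannedCone (wpsVec w '' S)

lemma exists_weighted_signs (w : Weights n) {S T : Set (Fin (n + 1))} (hS : S ≠ Set.univ)
    (hT : T ≠ Set.univ) : ∃ y : Fin (n + 1) → ℤ, (∀ i ∈ S, i ∉ T → 0 < y i) ∧
      (∀ i ∈ T, i ∉ S → y i < 0) ∧ (∀ i ∈ S, i ∈ T → y i = 0) ∧ ∑ i, w.a i * y i = 0 := by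
  obtain ⟨z, h1, h2, h3, h4⟩ := exists_signs hS hT 0
  have hb : ∀ i, (0 : ℤ) < ∏ j ∈ Finset.univ.erase i, (w.a j : ℤ) := fun i =>
    Finset.prod_pos fun j _ => by exact_mod_cast w.pos j
  refine ⟨fun i => (∏ j ∈ Finset.univ.erase i, (w.a j : ℤ)) * z i, ?_, ?_, ?_, ?_⟩
  · exact fun i hi hi' => mul_pos (hb i) (h1 i hi hi')
  · exact fun i hi hi' => mul_neg_of_pos_of_neg (hb i) (h2 i hi hi')
  · exact fun i hi hi' => by simp [h3 i hi hi']
  · have : ∀ i, (w.a i : ℤ) * ((∏ j ∈ Finset.univ.erase i, (w.a j : ℤ)) * z i) =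
        (∏ j, (w.a j : ℤ)) * z i := fun i => by
      rw [← mul_assoc, Finset.mul_prod_erase _ (fun j => (w.a j : ℤ)) (Finset.mem_univ i)]
    simp only [this]
    rw [← Finset.mul_sum, h4, mul_zero]

/-- The functional `x ↦ ∑ y_i x_i` on `ℤ^I`. -/
def dotHom {I : Type} [Fintype I] (y : I → ℤ) : (I → ℤ) →+ ℤ where
  toFun x := ∑ i, x i * y i
  map_zero' := by simp
  map_add' x x' := by simp [add_mul, Finset.sum_add_distrib]

lemma dotHom_single {I : Type} [Fintype I] [DecidableEq I] (y : I → ℤ) (i : I) :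
    dotHom y (Pi.single i 1) = y i := by
  simp [dotHom, Pi.single_apply]

/-- The fan of `ℙ(a_0, …, a_n)`: the cones spanned by the images of the proper subsets of the
standard basis of `ℤ^{n+1}`. -/
def wpsFan (w : Weights n) : Fan (wpsLattice w) :=
  complexFan (wpsVec w) {S | S ≠ Set.univ} (Set.empty_ne_univ)
    (fun S hS T hT h => hS (Set.univ_subset_iff.1 (h ▸ hT))) fun S hS T hT => by
      obtain ⟨y, h1, h2, h3, h4⟩ := exists_weighted_signs w hS hT
      let m : wpsLattice w →+ ℤ := QuotientAddGroup.lift _ (dotHom y) (by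
        rw [AddSubgroup.zmultiples_le]
        exact h4)
      have hm : ∀ i, m (wpsVec w i) = y i := fun i => dotHom_single y i
      exact ⟨m, by simpa only [hm] using ⟨h1, h2, h3⟩⟩

lemma mem_wpsFan (w : Weights n) (σ : PointedCone ℝ (RealSpace (wpsLattice w))) :
    σ ∈ (wpsFan w).cones ↔ ∃ S : Set (Fin (n + 1)), S ≠ Set.univ ∧ σ = wpsCone w S := Iff.rfl

/-- The maximal cone spanned by the images of all standard basis vectors but the `j`-th. -/
lemma wpsCone_compl_mem (w : Weights n) (j : Fin (n + 1)) :
    wpsCone w {j}ᶜ ∈ (wpsFan w).cones :=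
  ⟨{j}ᶜ, fun h => (h ▸ Set.mem_univ j : j ∈ ({j}ᶜ : Set _)) rfl, rfl⟩

/-! ### Toric weighted projective space bundles -/

/-- The `(n+1+k+1) × 2` matrix with rows `(a_i, -d_i)` and `(0, 1)`. -/
def bundleMatrix (w : Weights n) (d : Fin (n + 1) → ℤ) (k : ℕ) :
    Matrix (Fin (n + 1) ⊕ Fin (k + 1)) (Fin 2) ℤ :=
  Matrix.of (Sum.elim (fun i => ![(w.a i : ℤ), -d i]) fun _ => ![0, 1])

/-- The lattice `N`, the cokernel of `ℤ^2 → ℤ^{n+1} ⊕ ℤ^{k+1}`. -/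
def bundleLattice (w : Weights n) (d : Fin (n + 1) → ℤ) (k : ℕ) : Type :=
  (Fin (n + 1) ⊕ Fin (k + 1) → ℤ) ⧸ (bundleMatrix w d k).mulVecLin.toAddMonoidHom.range

instance (w : Weights n) (d : Fin (n + 1) → ℤ) (k : ℕ) : AddCommGroup (bundleLattice w d k) :=
  inferInstanceAs (AddCommGroup ((Fin (n + 1) ⊕ Fin (k + 1) → ℤ) ⧸ AddMonoidHom.range _))

/-- The quotient map `ℤ^{n+1} ⊕ ℤ^{k+1} → N`. -/
def bundleMk (w : Weights n) (d : Fin (n + 1) → ℤ) (k : ℕ) :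
    (Fin (n + 1) ⊕ Fin (k + 1) → ℤ) →+ bundleLattice w d k :=
  QuotientAddGroup.mk' (bundleMatrix w d k).mulVecLin.toAddMonoidHom.range

lemma bundleMk_surjective (w : Weights n) (d : Fin (n + 1) → ℤ) (k : ℕ) :
    Function.Surjective (bundleMk w d k) :=
  QuotientAddGroup.mk'_surjective _

lemma mem_range_bundleMatrix (w : Weights n) (d : Fin (n + 1) → ℤ) (k : ℕ)
    (x : Fin (n + 1) ⊕ Fin (k + 1) → ℤ) :
    x ∈ (bundleMatrix w d k).mulVecLin.toAddMonoidHom.range ↔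
      ∃ c b : ℤ, (∀ i, x (Sum.inl i) = c * w.a i - b * d i) ∧ ∀ j, x (Sum.inr j) = b := by
  constructor
  · rintro ⟨u, rfl⟩
    refine ⟨u 0, u 1, fun i => ?_, fun j => ?_⟩
    · simp [bundleMatrix, Matrix.mulVec, dotProduct, Fin.sum_univ_two]; ring
    · simp [bundleMatrix, Matrix.mulVec, dotProduct, Fin.sum_univ_two]
  · rintro ⟨c, b, h1, h2⟩
    refine ⟨![c, b], funext fun i => ?_⟩
    rcases i with i | j
    · simp [bundleMatrix, Matrix.mulVec, dotProduct, Fin.sum_univ_two, h1]; ring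
    · simp [bundleMatrix, Matrix.mulVec, dotProduct, Fin.sum_univ_two, h2]

lemma bundleMk_eq_zero (w : Weights n) (d : Fin (n + 1) → ℤ) (k : ℕ)
    (x : Fin (n + 1) ⊕ Fin (k + 1) → ℤ) : bundleMk w d k x = 0 ↔
      ∃ c b : ℤ, (∀ i, x (Sum.inl i) = c * w.a i - b * d i) ∧ ∀ j, x (Sum.inr j) = b :=
  (QuotientAddGroup.eq_zero_iff x).trans (mem_range_bundleMatrix w d k x)

instance (w : Weights n) (d : Fin (n + 1) → ℤ) (k : ℕ) : Module.Finite ℤ (bundleLattice w d k) :=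
  Module.Finite.of_surjective (bundleMk w d k).toIntLinearMap (bundleMk_surjective w d k)

instance (w : Weights n) (d : Fin (n + 1) → ℤ) (k : ℕ) : Module.Free ℤ (bundleLattice w d k) := by
  refine free_of_torsionFree _ fun p x hp hx => ?_
  obtain ⟨x, rfl⟩ := bundleMk_surjective w d k x
  rw [← map_zsmul, bundleMk_eq_zero] at hx
  obtain ⟨c, b, hc, hb⟩ := hx
  simp only [Pi.smul_apply, smul_eq_mul] at hc hb
  have hb0 := hb 0
  obtain ⟨c, rfl⟩ := w.dvd_of_forall_dvd (p := p) (c := c) fun i =>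
    ⟨x (Sum.inl i) + x (Sum.inr 0) * d i, by rw [mul_add, hc i, ← hb0]; ring⟩
  rw [bundleMk_eq_zero]
  refine ⟨c, x (Sum.inr 0), fun i => mul_left_cancel₀ hp ?_, fun j => mul_left_cancel₀ hp ?_⟩
  · rw [hc i, ← hb0]; ring
  · rw [hb j, hb0]

/-- The image in `N` of a standard basis vector: `e_i` for `Sum.inl i`, `f_j` for `Sum.inr j`. -/
def bundleVec (w : Weights n) (d : Fin (n + 1) → ℤ) (k : ℕ) (i : Fin (n + 1) ⊕ Fin (k + 1)) :
    bundleLattice w d k := bundleMk w d k (Pi.single i 1)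

/-- The cone spanned by the images of the standard basis vectors with index in `S`. -/
def bundleCone (w : Weights n) (d : Fin (n + 1) → ℤ) (k : ℕ)
    (S : Set (Fin (n + 1) ⊕ Fin (k + 1))) : PointedCone ℝ (RealSpace (bundleLattice w d k)) :=
  spannedCone (bundleVec w d k '' S)

/-- The sets of standard basis vectors that contain neither all `e_i` nor all `f_j`. -/
def bundleComplex (n k : ℕ) : Set (Set (Fin (n + 1) ⊕ Fin (k + 1))) :=
  {S | (∃ i, Sum.inl i ∉ S) ∧ ∃ j, Sum.inr j ∉ S}

/-- The fan of the toric weighted projective space bundle: the cones spanned by the images of the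
sets of standard basis vectors that contain neither all `e_i` nor all `f_j`. -/
def bundleFan (w : Weights n) (d : Fin (n + 1) → ℤ) (k : ℕ) : Fan (bundleLattice w d k) :=
  complexFan (bundleVec w d k) (bundleComplex n k) (by simp [bundleComplex])
    (fun _ hS _ hT => ⟨hS.1.imp fun _ hi h => hi (hT h), hS.2.imp fun _ hj h => hj (hT h)⟩)
    fun S hS T hT => by
      have ne_l : ∀ {S}, S ∈ bundleComplex n k → Sum.inl ⁻¹' S ≠ Set.univ := fun hS h => by
        obtain ⟨i, hi⟩ := hS.1
        exact hi (h ▸ Set.mem_univ i : i ∈ Sum.inl ⁻¹' _)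
      have ne_r : ∀ {S}, S ∈ bundleComplex n k → Sum.inr ⁻¹' S ≠ Set.univ := fun hS h => by
        obtain ⟨j, hj⟩ := hS.2
        exact hj (h ▸ Set.mem_univ j : j ∈ Sum.inr ⁻¹' _)
      obtain ⟨y, h1, h2, h3, h4⟩ := exists_weighted_signs w (ne_l hS) (ne_l hT)
      obtain ⟨z, g1, g2, g3, g4⟩ := exists_signs (ne_r hS) (ne_r hT) (∑ i, d i * y i)
      let m : bundleLattice w d k →+ ℤ := QuotientAddGroup.lift _ (dotHom (Sum.elim y z)) (by
        intro x hx
        obtain ⟨c, b, hc, hb⟩ := (mem_range_bundleMatrix w d k x).1 hx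
        simp only [AddMonoidHom.mem_ker, dotHom, AddMonoidHom.coe_mk, ZeroHom.coe_mk,
          Fintype.sum_sum_type, hc, hb, Sum.elim_inl, Sum.elim_inr, ← Finset.mul_sum, g4, sub_mul,
          Finset.sum_sub_distrib, mul_assoc, h4]
        ring)
      have hm : ∀ i, m (bundleVec w d k i) = Sum.elim y z i := fun i => dotHom_single _ i
      refine ⟨m, ?_⟩
      simp only [hm]
      exact ⟨Sum.forall.2 ⟨h1, g1⟩, Sum.forall.2 ⟨h2, g2⟩, Sum.forall.2 ⟨h3, g3⟩⟩

lemma mem_bundleFan (w : Weights n) (d : Fin (n + 1) → ℤ) (k : ℕ)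
    (σ : PointedCone ℝ (RealSpace (bundleLattice w d k))) : σ ∈ (bundleFan w d k).cones ↔
      ∃ S ∈ bundleComplex n k, σ = bundleCone w d k S := Iff.rfl

/-- The lattice map `N_{ℙ(a_0, …, a_n)} → N` induced by the inclusion
`ℤ^{n+1} → ℤ^{n+1} ⊕ ℤ^{k+1}` of the first summand. -/
def bundleIncl (w : Weights n) (d : Fin (n + 1) → ℤ) (k : ℕ) :
    wpsLattice w →+ bundleLattice w d k :=
  QuotientAddGroup.lift _ ((bundleMk w d k).comp
    { toFun := fun x => Sum.elim x 0
      map_zero' := by ext (i | j) <;> rfl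
      map_add' := fun x y => by ext (i | j) <;> simp }) (by
    rw [AddSubgroup.zmultiples_le]
    exact (bundleMk_eq_zero w d k _).2 ⟨1, 0, by simp, by simp⟩)

/-- The lattice map `N → N_{ℙ^k}` induced by the projection `ℤ^{n+1} ⊕ ℤ^{k+1} → ℤ^{k+1}` onto the
second summand. -/
def bundleProj (w : Weights n) (d : Fin (n + 1) → ℤ) (k : ℕ) (hk : 0 < k) :
    bundleLattice w d k →+ wpsLattice (Weights.one k hk) :=
  QuotientAddGroup.lift _ ((wpsMk (Weights.one k hk)).comp
    { toFun := fun x j => x (Sum.inr j)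
      map_zero' := rfl
      map_add' := fun _ _ => rfl }) (by
    intro x hx
    obtain ⟨c, b, -, hb⟩ := (mem_range_bundleMatrix w d k x).1 hx
    exact (wpsMk_eq_zero _ _).2 ⟨b, fun j => by simp [hb, Weights.one]⟩)

/-- The block matrix `(I M; 0 I)`, where the only nonzero column of `M` is the `j`-th one, which is
`(d_0, …, d_n)`. -/
def twistMatrix (d : Fin (n + 1) → ℤ) {k : ℕ} (j : Fin (k + 1)) :
    Matrix (Fin (n + 1) ⊕ Fin (k + 1)) (Fin (n + 1) ⊕ Fin (k + 1)) ℤ :=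
  Matrix.fromBlocks 1 (Matrix.of fun i l => if l = j then d i else 0) 0 1

end Toric

end

/-!
The bundle is trivial over `U_j` for a combinatorial reason. A cone of `Σ` lies over `σ_j` exactly
when it omits the generator `f_j`, and the lattice isomorphism `ψ_j` sends the remaining generators
`e_i` and `f_l`, `l ≠ j`, to `(e_i, 0)` and `(0, f_l)`. So it carries the cones of `Σ` over `σ_j`,
or over any cone of `ℙ^k` that omits `f_j`, to product cones (`Toric.bundleCone_eq`).

To pass to schemes, let `τ` be a cone of the base and consider the subfan of the cones that lie over
`τ` (`Toric.Fan.preimage`). Its toric variety is the preimage of `U_τ`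
(`Toric.Fan.isPullback_preimage`) and, once `ψ` identifies its cones with products, also the product
of the fiber and `U_τ` (`Toric.Fan.isPullback_prod`). Both are pullback squares that can be checked
on an open cover (`Toric.isPullback_of_openCover`). There they rest on two facts about charts: the
preimage of `U_τ` in `U_σ` is the chart of the face `{x ∈ σ | φ_ℝ(x) ∈ τ}`
(`Toric.Fan.exists_of_toricMap_eq`), and the chart of a product cone is the product of the charts
(`Toric.isPullback_chart_prod`), since the monoid algebra of a product of monoids is a coproduct.

The fiber over the identity of the torus is computed in the trivialization over the zero cone, where
the inclusion of the fiber is a section of the first projection (`Toric.Fan.isPullback_fiber`).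
-/

noncomputable section

namespace Toric

/-! ### Pullback squares of schemes -/

/-- A commutative square of schemes is a pullback square if it is one over each member of an open
cover `𝒰` of `X`. The restriction of `p` to `𝒰.X i` is presented by a pullback square with corner
`P i` of one's choice. -/
lemma isPullback_of_openCover {X Y U B : Scheme.{0}} {p : Y ⟶ X} {q : Y ⟶ U} {f : X ⟶ B}
    {g : U ⟶ B} (w : p ≫ f = q ≫ g) (𝒰 : X.OpenCover) {P : 𝒰.I₀ → Scheme.{0}}
    (a : ∀ i, P i ⟶ Y) (b : ∀ i, P i ⟶ 𝒰.X i) (hp : ∀ i, IsPullback (a i) (b i) p (𝒰.f i))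
    (hq : ∀ i, IsPullback (b i) (a i ≫ q) (𝒰.f i ≫ f) g) : IsPullback p q f g := by
  have : IsIso (pullback.lift p q w) := by
    refine IsZariskiLocalAtTarget.of_openCover (P := MorphismProperty.isomorphisms Scheme)
      (𝒰 := 𝒰.pullback₁ (pullback.fst f g)) fun i => ?_
    let W := pullback (pullback.fst f g) (𝒰.f i)
    let w₁ : W ⟶ pullback f g := pullback.fst _ _
    let w₂ : W ⟶ 𝒰.X i := pullback.snd _ _
    have hw : IsPullback w₁ w₂ (pullback.fst f g) (𝒰.f i) := IsPullback.of_hasPullback _ _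
    have hwU : IsPullback w₂ (w₁ ≫ pullback.snd f g) (𝒰.f i ≫ f) g :=
      hw.flip.paste_vert (IsPullback.of_hasPullback f g)
    let c : P i ⟶ W := hw.lift (a i ≫ pullback.lift p q w) (b i)
      (by rw [Category.assoc, pullback.lift_fst, (hp i).w])
    have hc₁ : c ≫ w₁ = a i ≫ pullback.lift p q w := hw.lift_fst _ _ _
    have hc₂ : c ≫ w₂ = b i := hw.lift_snd _ _ _
    have hsq : IsPullback (a i) c (pullback.lift p q w) w₁ := by
      refine IsPullback.of_bot ?_ hc₁.symm hw
      rw [hc₂, pullback.lift_fst]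
      exact hp i
    have hciso : IsIso c := by
      have e : c = ((hq i).isoIsPullback _ _ hwU).hom := by
        refine hwU.hom_ext ?_ ?_
        · rw [hc₂, IsPullback.isoIsPullback_hom_fst]
        · rw [reassoc_of% hc₁, IsPullback.isoIsPullback_hom_snd, pullback.lift_snd]
      rw [e]
      infer_instance
    have e : pullback.snd (pullback.lift p q w) w₁ = hsq.isoPullback.inv ≫ c := by simp
    change IsIso (pullback.snd (pullback.lift p q w) w₁)
    rw [e]
    infer_instance
  exact IsPullback.of_iso_pullback ⟨w⟩ (asIso (pullback.lift p q w)) (pullback.lift_fst _ _ _)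
    (pullback.lift_snd _ _ _)

/-! ### Monoid algebras of products and charts of product cones -/

/-- The monoid algebra of a product of commutative monoids is the coproduct of the monoid algebras
of the factors. -/
lemma isPushout_addMonoidAlgebra {A B C : Type} [AddCommMonoid A] [AddCommMonoid B]
    [AddCommMonoid C] (i : A →+ C) (j : B →+ C)
    (h : Function.Bijective (AddMonoidHom.coprod i j)) :
    IsPushout (CommRingCat.ofHom (algebraMap ℂ (AddMonoidAlgebra ℂ A)))
      (CommRingCat.ofHom (algebraMap ℂ (AddMonoidAlgebra ℂ B)))
      (CommRingCat.ofHom (AddMonoidAlgebra.mapDomainRingHom ℂ i))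
      (CommRingCat.ofHom (AddMonoidAlgebra.mapDomainRingHom ℂ j)) := by
  let e : A × B ≃+ C := AddEquiv.ofBijective (AddMonoidHom.coprod i j) h
  have hi : ∀ x, e.symm (i x) = (x, 0) := fun x =>
    (AddEquiv.symm_apply_eq e).2 (by simp [e])
  have hj : ∀ x, e.symm (j x) = (0, x) := fun x =>
    (AddEquiv.symm_apply_eq e).2 (by simp [e])
  have hC : ∀ c, c = i (e.symm c).1 + j (e.symm c).2 := fun c =>
    (AddEquiv.apply_symm_apply e c).symm.trans (AddMonoidHom.coprod_apply i j _)
  have w : CommRingCat.ofHom (algebraMap ℂ (AddMonoidAlgebra ℂ A)) ≫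
      CommRingCat.ofHom (AddMonoidAlgebra.mapDomainRingHom ℂ i) =
      CommRingCat.ofHom (algebraMap ℂ (AddMonoidAlgebra ℂ B)) ≫
      CommRingCat.ofHom (AddMonoidAlgebra.mapDomainRingHom ℂ j) := by
    ext x; simp
  refine ⟨⟨w⟩, ⟨PushoutCocone.IsColimit.mk w (fun s => CommRingCat.ofHom
    (AddMonoidAlgebra.liftNCRingHom (s.inl.hom.comp (algebraMap ℂ _))
      { toFun := fun c => s.inl (AddMonoidAlgebra.single (e.symm c.toAdd).1 1) *
          s.inr (AddMonoidAlgebra.single (e.symm c.toAdd).2 1)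
        map_one' := by
          simp [← AddMonoidAlgebra.one_def]
        map_mul' := fun x y => by
          have : ∀ {M : Type} [AddCommMonoid M] (a b : M), AddMonoidAlgebra.single (a + b) (1 : ℂ) =
              AddMonoidAlgebra.single a 1 * AddMonoidAlgebra.single b 1 := fun a b => by
            rw [AddMonoidAlgebra.single_mul_single, mul_one]
          simp only [toAdd_mul, map_add, Prod.fst_add, Prod.snd_add, this, map_mul]
          ring } fun _ _ => Commute.all _ _)) ?_ ?_ ?_⟩⟩
  · intro s
    ext : 1
    refine AddMonoidAlgebra.ringHom_ext (fun r => ?_) fun m => ?_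
    · simp [AddMonoidAlgebra.liftNCRingHom_single, ← AddMonoidAlgebra.one_def]
    · simp [AddMonoidAlgebra.liftNCRingHom_single, hi, ← AddMonoidAlgebra.one_def]
  · intro s
    have hs : ∀ r : ℂ, s.inl.hom (AddMonoidAlgebra.single 0 r) =
        s.inr.hom (AddMonoidAlgebra.single 0 r) := fun r => by
      simpa using congr($(s.condition).hom r)
    ext : 1
    refine AddMonoidAlgebra.ringHom_ext (fun r => ?_) fun m => ?_
    · simp [AddMonoidAlgebra.liftNCRingHom_single, ← AddMonoidAlgebra.one_def, hs]
    · simp [AddMonoidAlgebra.liftNCRingHom_single, hj, ← AddMonoidAlgebra.one_def]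
  · intro s m h₁ h₂
    have g₁ : ∀ x, m.hom (AddMonoidAlgebra.mapDomain i x) = s.inl.hom x := fun x =>
      congr($(h₁).hom x)
    have g₂ : ∀ x, m.hom (AddMonoidAlgebra.mapDomain j x) = s.inr.hom x := fun x =>
      congr($(h₂).hom x)
    ext : 1
    refine AddMonoidAlgebra.ringHom_ext (fun r => ?_) fun c => ?_
    · simp [AddMonoidAlgebra.liftNCRingHom_single, ← AddMonoidAlgebra.one_def, ← g₁]
    · have hc : (AddMonoidAlgebra.single c 1 : AddMonoidAlgebra ℂ C) =
          AddMonoidAlgebra.mapDomain i (AddMonoidAlgebra.single (e.symm c).1 1) *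
          AddMonoidAlgebra.mapDomain j (AddMonoidAlgebra.single (e.symm c).2 1) := by
        rw [AddMonoidAlgebra.mapDomain_single, AddMonoidAlgebra.mapDomain_single,
          AddMonoidAlgebra.single_mul_single, ← hC, mul_one]
      rw [hc, map_mul, g₁, g₂, ← hc]
      simp only [CommRingCat.hom_ofHom, AddMonoidAlgebra.liftNCRingHom_single, map_one, one_mul]
      rfl

lemma realMap_zero {N N' : Type} [AddCommGroup N] [AddCommGroup N'] (x : RealSpace N) :
    realMap (0 : N →+ N') x = 0 := by
  have : realMap (0 : N →+ N') = 0 := by ext; simp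
  simp [this]

/-- If a lattice isomorphism onto a product carries `σ` onto the product cone `κ × τ`, then
`U_σ = U_κ × U_τ`. -/
lemma isPullback_chart_prod {N NF NB : Type} [AddCommGroup N] [AddCommGroup NF] [AddCommGroup NB]
    (ψ : N ≃+ NF × NB) {σ : PointedCone ℝ (RealSpace N)} {κ : PointedCone ℝ (RealSpace NF)}
    {τ : PointedCone ℝ (RealSpace NB)} {φ₁ : N →+ NF} {φ₂ : N →+ NB}
    (e₁ : φ₁ = (AddMonoidHom.fst NF NB).comp ψ.toAddMonoidHom)
    (e₂ : φ₂ = (AddMonoidHom.snd NF NB).comp ψ.toAddMonoidHom)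
    (hσ : ∀ x, x ∈ σ ↔ realMap φ₁ x ∈ κ ∧ realMap φ₂ x ∈ τ)
    (h₁ : MapsInto φ₁ σ κ) (h₂ : MapsInto φ₂ σ τ) :
    IsPullback (chartMap φ₁ h₁) (chartMap φ₂ h₂) (chartStr κ) (chartStr τ) := by
  refine isPullback_SpecMap_of_isPushout _ _ _ _ (isPushout_addMonoidAlgebra _ _ ?_)
  let i₁ : NF →+ N := ψ.symm.toAddMonoidHom.comp (AddMonoidHom.inl NF NB)
  let i₂ : NB →+ N := ψ.symm.toAddMonoidHom.comp (AddMonoidHom.inr NF NB)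
  have c₁₁ : φ₁.comp i₁ = AddMonoidHom.id _ := by ext; simp [e₁, i₁]
  have c₁₂ : φ₁.comp i₂ = 0 := by ext; simp [e₁, i₂]
  have c₂₁ : φ₂.comp i₁ = 0 := by ext; simp [e₂, i₁]
  have c₂₂ : φ₂.comp i₂ = AddMonoidHom.id _ := by ext; simp [e₂, i₂]
  have hi₁ : MapsInto i₁ κ σ := fun x hx => by
    rw [hσ, ← realMap_comp, ← realMap_comp, c₁₁, c₂₁, realMap_id, realMap_zero]
    exact ⟨hx, zero_mem _⟩
  have hi₂ : MapsInto i₂ τ σ := fun x hx => by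
    rw [hσ, ← realMap_comp, ← realMap_comp, c₁₂, c₂₂, realMap_id, realMap_zero]
    exact ⟨zero_mem _, hx⟩
  have hsum : ∀ x, i₁ (φ₁ x) + i₂ (φ₂ x) = x := fun x => by
    simp [i₁, i₂, e₁, e₂, ← map_add]
  have d₁₁ : ∀ x, φ₁ (i₁ x) = x := fun x => DFunLike.congr_fun c₁₁ x
  have d₁₂ : ∀ x, φ₁ (i₂ x) = 0 := fun x => DFunLike.congr_fun c₁₂ x
  have d₂₁ : ∀ x, φ₂ (i₁ x) = 0 := fun x => DFunLike.congr_fun c₂₁ x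
  have d₂₂ : ∀ x, φ₂ (i₂ x) = x := fun x => DFunLike.congr_fun c₂₂ x
  refine Function.bijective_iff_has_inverse.2
    ⟨fun m => (dualMonoidMap i₁ hi₁ m, dualMonoidMap i₂ hi₂ m), fun m => ?_, fun m => ?_⟩
  · refine Prod.ext (Subtype.ext ?_) (Subtype.ext ?_)
    · ext x; simp [dualMonoidMap, d₁₁, d₂₁]
    · ext x; simp [dualMonoidMap, d₁₂, d₂₂]
  · refine Subtype.ext ?_
    ext x
    simp [dualMonoidMap, ← map_add, hsum]

/-! ### Toric morphisms over affine charts -/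

lemma mapsInto_inf_comap {N N' : Type} [AddCommGroup N] [AddCommGroup N'] (φ : N →+ N')
    (σ : PointedCone ℝ (RealSpace N)) (τ : PointedCone ℝ (RealSpace N')) :
    MapsInto φ (σ ⊓ τ.comap (realMap φ)) τ :=
  fun _ hx => hx.2

namespace Fan

variable {N N' N'' : Type} [AddCommGroup N] [AddCommGroup N'] [AddCommGroup N'']
  [Module.Free ℤ N] [Module.Finite ℤ N] [Module.Free ℤ N'] [Module.Finite ℤ N']
  [Module.Free ℤ N''] [Module.Finite ℤ N'']

/-- The open cover of `X_Σ` by the affine charts `U_σ`. -/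
abbrev chartCover (F : Fan N) : F.toricVariety.OpenCover :=
  Scheme.IsLocallyDirected.openCover F.diagram

lemma exists_ι_eq (F : Fan N) (p : F.toricVariety) :
    ∃ σ, ∃ hσ : σ ∈ F.cones, ∃ x : chart σ, F.ι hσ x = p := by
  obtain ⟨σ, x, h⟩ := Scheme.IsLocallyDirected.ι_jointly_surjective F.diagram p
  exact ⟨σ.1, σ.2, x, h⟩

/-- Charts `U_σ` and `U_τ` of a toric variety meet only in `U_{σ ∩ τ}`. -/
lemma exists_of_ι_eq_ι (F : Fan N) {σ τ : PointedCone ℝ (RealSpace N)} (hσ : σ ∈ F.cones)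
    (hτ : τ ∈ F.cones) {x : chart σ} {y : chart τ} (h : F.ι hσ x = F.ι hτ y) :
    ∃ z : chart (σ ⊓ τ), chartMap (AddMonoidHom.id N) (MapsInto.of_le inf_le_left) z = x := by
  obtain ⟨ρ, f, g, z, h₁, -⟩ :=
    (Scheme.IsLocallyDirected.ι_eq_ι_iff F.diagram (i := ⟨σ, hσ⟩) (j := ⟨τ, hτ⟩)).1 h
  have hle : ρ.1 ≤ σ ⊓ τ := le_inf (leOfHom f) (leOfHom g)
  refine ⟨chartMap (AddMonoidHom.id N) (MapsInto.of_le hle) z, Eq.trans ?_ h₁⟩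
  exact congr($(chartMap_comp (AddMonoidHom.id N) (AddMonoidHom.id N) (MapsInto.of_le hle)
    (MapsInto.of_le inf_le_left)) z)

/-- The functional `m` that cuts out the face `σ' ∩ τ` of `σ'` pulls back to a functional that cuts
out the face `{x ∈ σ | φ_ℝ(x) ∈ τ}` of `σ`. -/
lemma isFace_inf_comap {L : Type} [AddCommGroup L] (F' : Fan N') {φ : L →+ N'}
    {σ : PointedCone ℝ (RealSpace L)}
    {σ' τ : PointedCone ℝ (RealSpace N')} (hσ' : σ' ∈ F'.cones) (hτ : τ ∈ F'.cones)
    (h : MapsInto φ σ σ') : ∃ m : dualMonoid σ',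
      (∀ x, x ∈ σ' ⊓ τ ↔ x ∈ σ' ∧ pairing m.1 x = 0) ∧
      ∀ x, x ∈ σ ⊓ τ.comap (realMap φ) ↔ x ∈ σ ∧ pairing (dualMonoidMap φ h m).1 x = 0 := by
  obtain ⟨m, hm, hm'⟩ := (F'.inter_face σ' hσ' τ hτ).1
  refine ⟨⟨m, hm⟩, hm', fun x => ?_⟩
  rw [Submodule.mem_inf, PointedCone.mem_comap]
  refine and_congr_right fun hx => ?_
  change _ ↔ pairing (m.comp φ) x = 0
  rw [pairing_comp]
  have := hm' (realMap φ x)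
  rw [Submodule.mem_inf] at this
  exact ⟨fun hx' => (this.1 ⟨h x hx, hx'⟩).2, fun hx' => (this.2 ⟨h x hx, hx'⟩).2⟩

lemma inf_comap_mem {F : Fan N} {F' : Fan N'} {φ : N →+ N'} (h : IsFanMap φ F F')
    {σ : PointedCone ℝ (RealSpace N)} {τ : PointedCone ℝ (RealSpace N')}
    (hσ : σ ∈ F.cones) (hτ : τ ∈ F'.cones) : σ ⊓ τ.comap (realMap φ) ∈ F.cones := by
  obtain ⟨σ', hσ', hφ⟩ := h σ hσ
  obtain ⟨m, -, hm⟩ := F'.isFace_inf_comap hσ' hτ hφ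
  exact F.face_mem σ hσ _ ⟨_, (dualMonoidMap φ hφ m).2, hm⟩

/-- A toric morphism sends a point of the chart `U_σ` into the chart `U_τ` only if the point lies in
the chart of the face `{x ∈ σ | φ_ℝ(x) ∈ τ}`: for a cone `σ' ⊇ φ_ℝ(σ)`, the face `σ' ∩ τ` of `σ'` is
cut out by some `m`, that is, `U_{σ' ∩ τ} ⊆ U_σ'` is the locus where the character of `m` does not
vanish, and so its preimage in `U_σ` is the locus where the character of `m ∘ φ` does not vanish. -/
lemma exists_of_toricMap_eq {F : Fan N} {F' : Fan N'} {φ : N →+ N'} (h : IsFanMap φ F F')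
    {σ : PointedCone ℝ (RealSpace N)} {τ : PointedCone ℝ (RealSpace N')}
    (hσ : σ ∈ F.cones) (hτ : τ ∈ F'.cones) {x : chart σ} {y : chart τ}
    (hxy : toricMap h (F.ι hσ x) = F'.ι hτ y) :
    ∃ z : chart (σ ⊓ τ.comap (realMap φ)),
      chartMap (AddMonoidHom.id N) (MapsInto.of_le inf_le_left) z = x := by
  obtain ⟨σ', hσ', hφ⟩ := h σ hσ
  obtain ⟨m, hm', hm⟩ := F'.isFace_inf_comap hσ' hτ hφ
  obtain ⟨S, hS, hSσ⟩ := F.rational σ hσ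
  obtain ⟨S', hS', hSσ'⟩ := F'.rational σ' hσ'
  rw [← Scheme.Hom.comp_apply, ι_toricMap h hσ hσ' hφ, Scheme.Hom.comp_apply] at hxy
  obtain ⟨z, hz⟩ := F'.exists_of_ι_eq_ι hσ' hτ hxy
  have h₁ : chartMap φ hφ x ∈ Set.range (chartMap (AddMonoidHom.id N')
      (MapsInto.of_le (inf_le_left : σ' ⊓ τ ≤ σ'))) := ⟨z, hz⟩
  rw [range_face hS' hSσ' m hm'] at h₁
  change x ∈ Set.range (chartMap (AddMonoidHom.id N)
    (MapsInto.of_le (inf_le_left : σ ⊓ τ.comap (realMap φ) ≤ σ)))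
  rw [range_face hS hSσ (dualMonoidMap φ hφ m) hm]
  intro hx
  apply h₁
  change AddMonoidAlgebra.mapDomainRingHom ℂ (dualMonoidMap φ hφ)
    (AddMonoidAlgebra.single m 1) ∈ PrimeSpectrum.asIdeal x
  rw [AddMonoidAlgebra.mapDomainRingHom_apply, AddMonoidAlgebra.mapDomain_single]
  exact hx

lemma isOpenImmersion_chartMap_inf_comap {F : Fan N} {F' : Fan N'} {φ : N →+ N'}
    (h : IsFanMap φ F F') {σ : PointedCone ℝ (RealSpace N)} {τ : PointedCone ℝ (RealSpace N')}
    (hσ : σ ∈ F.cones) (hτ : τ ∈ F'.cones) :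
    IsOpenImmersion (chartMap (AddMonoidHom.id N)
      (MapsInto.of_le (inf_le_left : σ ⊓ τ.comap (realMap φ) ≤ σ))) := by
  obtain ⟨S, hS, hSσ⟩ := F.rational σ hσ
  exact isOpenImmersion_face hS hSσ
    (F.isFace_of_le (inf_comap_mem h hσ hτ) hσ inf_le_left) _

/-- Inside the chart `U_σ`, the preimage of the chart `U_τ` is the chart of the face
`{x ∈ σ | φ_ℝ(x) ∈ τ}`. -/
lemma isPullback_chart {F : Fan N} {F' : Fan N'} {φ : N →+ N'} (h : IsFanMap φ F F')
    {σ : PointedCone ℝ (RealSpace N)} {τ : PointedCone ℝ (RealSpace N')}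
    (hσ : σ ∈ F.cones) (hτ : τ ∈ F'.cones) :
    IsPullback (chartMap (AddMonoidHom.id N)
        (MapsInto.of_le (inf_le_left : σ ⊓ τ.comap (realMap φ) ≤ σ)))
      (chartMap φ (mapsInto_inf_comap φ σ τ)) (F.ι hσ ≫ toricMap h) (F'.ι hτ) := by
  have := isOpenImmersion_chartMap_inf_comap h hσ hτ
  have w : chartMap (AddMonoidHom.id N)
        (MapsInto.of_le (inf_le_left : σ ⊓ τ.comap (realMap φ) ≤ σ)) ≫ F.ι hσ ≫ toricMap h =
      chartMap φ (mapsInto_inf_comap φ σ τ) ≫ F'.ι hτ := by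
    rw [← Category.assoc, F.chartMap_ι (inf_comap_mem h hσ hτ) hσ,
      ι_toricMap h (inf_comap_mem h hσ hτ) hτ]
  refine (IsOpenImmersion.isPullback _ _ _ _ w ?_).flip
  ext x
  constructor
  · rintro ⟨y, hy⟩
    exact exists_of_toricMap_eq h hσ hτ (x := x) (y := y)
      (by rw [← Scheme.Hom.comp_apply]; exact hy.symm)
  · rintro ⟨z, rfl⟩
    refine ⟨chartMap φ (mapsInto_inf_comap φ σ τ) z, ?_⟩
    rw [← Scheme.Hom.comp_apply, ← Scheme.Hom.comp_apply, w]

/-- If the cones of `F` over `τ` have a largest element `σ`, then `U_σ` is the preimage of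
`U_τ`. -/
lemma isPullback_ι {F : Fan N} {F' : Fan N'} {φ : N →+ N'} (h : IsFanMap φ F F')
    {σ : PointedCone ℝ (RealSpace N)} {τ : PointedCone ℝ (RealSpace N')}
    (hσ : σ ∈ F.cones) (hτ : τ ∈ F'.cones) (hφ : MapsInto φ σ τ)
    (hmax : ∀ ρ ∈ F.cones, MapsInto φ ρ τ → ρ ≤ σ) :
    IsPullback (F.ι hσ) (chartMap φ hφ) (toricMap h) (F'.ι hτ) := by
  refine (IsOpenImmersion.isPullback _ _ _ _ (ι_toricMap h hσ hτ hφ) ?_).flip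
  ext p
  constructor
  · rintro ⟨y, hy⟩
    obtain ⟨ρ, hρ, x, rfl⟩ := F.exists_ι_eq p
    obtain ⟨z, rfl⟩ := exists_of_toricMap_eq h hρ hτ hy.symm
    have hmem := inf_comap_mem h hρ hτ
    have hle := hmax _ hmem (mapsInto_inf_comap φ ρ τ)
    refine ⟨chartMap (AddMonoidHom.id N) (MapsInto.of_le hle) z, ?_⟩
    rw [← Scheme.Hom.comp_apply, ← Scheme.Hom.comp_apply, F.chartMap_ι hmem hσ,
      F.chartMap_ι hmem hρ]
  · rintro ⟨z, rfl⟩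
    refine ⟨chartMap φ hφ z, ?_⟩
    rw [← Scheme.Hom.comp_apply, ← Scheme.Hom.comp_apply, ι_toricMap h hσ hτ hφ]

/-- The toric morphism `X_Σ ⟶ U_τ` induced by a linear map that sends every cone of `Σ` into
`τ`. -/
def toChart {L : Type} [AddCommGroup L] {F : Fan N} {φ : N →+ L}
    {τ : PointedCone ℝ (RealSpace L)} (h : ∀ σ ∈ F.cones, MapsInto φ σ τ) :
    F.toricVariety ⟶ chart τ :=
  colimit.desc F.diagram
    { pt := _
      ι := { app := fun σ => chartMap φ (h σ.1 σ.2)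
             naturality := fun _ _ _ => (chartMap_comp _ _ _ _).trans
              ((chartMap_congr (AddMonoidHom.comp_id _) _ _).trans (Category.comp_id _).symm) } }

lemma ι_toChart {L : Type} [AddCommGroup L] {F : Fan N} {φ : N →+ L}
    {τ : PointedCone ℝ (RealSpace L)} (h : ∀ σ ∈ F.cones, MapsInto φ σ τ)
    {σ : PointedCone ℝ (RealSpace N)} (hσ : σ ∈ F.cones) :
    F.ι hσ ≫ toChart h = chartMap φ (h σ hσ) :=
  colimit.ι_desc _ _

lemma toricMap_comp {F : Fan N} {F' : Fan N'} {F'' : Fan N''} {φ : N →+ N'} {ψ : N' →+ N''}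
    (h : IsFanMap φ F F') (h' : IsFanMap ψ F' F'') (h'' : IsFanMap (ψ.comp φ) F F'') :
    toricMap h ≫ toricMap h' = toricMap h'' := by
  refine F.hom_ext fun σ hσ => ?_
  obtain ⟨σ', hσ', hφ⟩ := h σ hσ
  obtain ⟨σ'', hσ'', hψ⟩ := h' σ' hσ'
  rw [← Category.assoc, ι_toricMap h hσ hσ' hφ, Category.assoc, ι_toricMap h' hσ' hσ'' hψ,
    ι_toricMap h'' hσ hσ'' (hψ.comp hφ), ← Category.assoc, chartMap_comp]

lemma toricMap_id {F : Fan N} (h : IsFanMap (AddMonoidHom.id N) F F) :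
    toricMap h = 𝟙 F.toricVariety := by
  refine F.hom_ext fun σ hσ => ?_
  rw [ι_toricMap h hσ hσ (MapsInto.of_le le_rfl), chartMap_id, Category.id_comp, Category.comp_id]

/-- The subfan of the cones that lie over `τ`, the fan of the preimage of `U_τ`. -/
def preimage {L : Type} [AddCommGroup L] (F : Fan N) (φ : N →+ L)
    (τ : PointedCone ℝ (RealSpace L)) : Fan N where
  cones := {σ | σ ∈ F.cones ∧ MapsInto φ σ τ}
  finite := F.finite.subset fun _ h => h.1
  bot_mem := ⟨F.bot_mem, fun x hx => by
    rw [(Submodule.mem_bot _).1 hx, map_zero]; exact zero_mem τ⟩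
  rational σ hσ := F.rational σ hσ.1
  salient σ hσ := F.salient σ hσ.1
  face_mem σ hσ ρ hρ := ⟨F.face_mem σ hσ.1 ρ hρ, fun x hx => by
    obtain ⟨m, -, hm⟩ := hρ
    exact hσ.2 x ((hm x).1 hx).1⟩
  inter_face σ hσ ρ hρ := F.inter_face σ hσ.1 ρ hρ.1

lemma isFanMap_preimage {L : Type} [AddCommGroup L] (F : Fan N) (φ : N →+ L)
    (τ : PointedCone ℝ (RealSpace L)) :
    IsFanMap (AddMonoidHom.id N) (F.preimage φ τ) F :=
  fun σ hσ => ⟨σ, hσ.1, MapsInto.of_le le_rfl⟩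

lemma mapsInto_of_mem_preimage {L : Type} [AddCommGroup L] (F : Fan N) (φ : N →+ L)
    (τ : PointedCone ℝ (RealSpace L)) :
    ∀ σ ∈ (F.preimage φ τ).cones, MapsInto φ σ τ := fun _ hσ => hσ.2

/-- The toric variety of the cones over `τ` is the preimage of `U_τ`: over a chart `U_σ` both are
the chart of the face `{x ∈ σ | φ_ℝ(x) ∈ τ}`. -/
theorem isPullback_preimage {F : Fan N} {F' : Fan N'} {φ : N →+ N'} (h : IsFanMap φ F F')
    {τ : PointedCone ℝ (RealSpace N')} (hτ : τ ∈ F'.cones) :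
    IsPullback (toricMap (F.isFanMap_preimage φ τ)) (toChart (F.mapsInto_of_mem_preimage φ τ))
      (toricMap h) (F'.ι hτ) := by
  have hmem : ∀ σ : F.Index, σ.1 ⊓ τ.comap (realMap φ) ∈ (F.preimage φ τ).cones := fun σ =>
    ⟨inf_comap_mem h σ.2 hτ, mapsInto_inf_comap φ σ.1 τ⟩
  refine isPullback_of_openCover ?_ F.chartCover
    (P := fun σ : F.Index => chart (σ.1 ⊓ τ.comap (realMap φ)))
    (fun σ => (F.preimage φ τ).ι (hmem σ))
    (fun σ => chartMap (AddMonoidHom.id N) (MapsInto.of_le inf_le_left)) (fun σ => ?_) fun σ => ?_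
  · refine (F.preimage φ τ).hom_ext fun σ hσ => ?_
    rw [← Category.assoc, ← Category.assoc, ι_toChart,
      ι_toricMap _ hσ hσ.1 (MapsInto.of_le le_rfl), chartMap_id, Category.id_comp,
      ι_toricMap h hσ.1 hτ hσ.2]
  · exact isPullback_ι (F.isFanMap_preimage φ τ) (hmem σ) σ.2 _ fun ρ hρ hρσ x hx =>
      ⟨by simpa [realMap_id] using hρσ x hx, hρ.2 x hx⟩
  · rw [ι_toChart]
    exact isPullback_chart h σ.2 hτ

/-- If, under a lattice isomorphism `N ≅ N_F × N_B`, every cone of `G` maps into a cone of `FF` and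
into `τ`, and every product cone `κ × τ`, `κ ∈ FF`, is a cone of `G`, then the toric variety of `G`
is the product of that of `FF` and `U_τ`: the preimage of the chart `U_κ` is the chart of the cone
`κ × τ`, which is `U_κ × U_τ`. -/
theorem isPullback_prod {NF NB : Type} [AddCommGroup NF] [AddCommGroup NB]
    [Module.Free ℤ NF] [Module.Finite ℤ NF] {G : Fan N} {FF : Fan NF} (ψ : N ≃+ NF × NB)
    {φ₁ : N →+ NF} {φ₂ : N →+ NB} (e₁ : φ₁ = (AddMonoidHom.fst NF NB).comp ψ.toAddMonoidHom)
    (e₂ : φ₂ = (AddMonoidHom.snd NF NB).comp ψ.toAddMonoidHom) (h₁ : IsFanMap φ₁ G FF)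
    {τ : PointedCone ℝ (RealSpace NB)} (h₂ : ∀ σ ∈ G.cones, MapsInto φ₂ σ τ)
    (hprod : ∀ κ ∈ FF.cones, κ.comap (realMap φ₁) ⊓ τ.comap (realMap φ₂) ∈ G.cones) :
    IsPullback (toricMap h₁) (toChart h₂) FF.str (chartStr τ) := by
  have hm : ∀ κ : PointedCone ℝ (RealSpace NF),
      MapsInto φ₁ (κ.comap (realMap φ₁) ⊓ τ.comap (realMap φ₂)) κ := fun κ x hx => hx.1
  refine isPullback_of_openCover ?_ FF.chartCover
    (P := fun κ : FF.Index => chart (κ.1.comap (realMap φ₁) ⊓ τ.comap (realMap φ₂)))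
    (fun κ => G.ι (hprod κ.1 κ.2)) (fun κ => chartMap φ₁ (hm κ.1)) (fun κ => ?_) fun κ => ?_
  · refine G.hom_ext fun σ hσ => ?_
    obtain ⟨κ, hκ, hσκ⟩ := h₁ σ hσ
    rw [← Category.assoc, ← Category.assoc, ι_toChart, ι_toricMap h₁ hσ hκ hσκ, Category.assoc,
      ι_str, chartMap_str, chartMap_str]
  · exact isPullback_ι h₁ (hprod κ.1 κ.2) κ.2 (hm κ.1) fun ρ hρ hρκ x hx =>
      ⟨hρκ x hx, h₂ ρ hρ x hx⟩
  · rw [ι_toChart]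
    have : FF.chartCover.f κ ≫ FF.str = chartStr κ.1 := FF.ι_str κ.2
    rw [this]
    exact isPullback_chart_prod ψ e₁ e₂ (fun x => Iff.rfl) (hm κ.1) _

end Fan

/-! ### Trivializations and fibers of toric morphisms -/

/-- The identity element of the torus `Spec ℂ[M]`. -/
def torusOne (N : Type) [AddCommGroup N] :
    Spec (CommRingCat.of ℂ) ⟶ chart (⊥ : PointedCone ℝ (RealSpace N)) :=
  Spec.map (CommRingCat.ofHom (AddMonoidAlgebra.lift ℂ ℂ
    (dualMonoid (⊥ : PointedCone ℝ (RealSpace N))) 1).toRingHom)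

lemma torusOne_str (N : Type) [AddCommGroup N] : torusOne N ≫ chartStr ⊥ = 𝟙 _ := by
  unfold torusOne chartStr
  rw [← Spec.map_comp, ← CommRingCat.ofHom_comp, ← Spec.map_id]
  congr 1
  ext x
  simp

lemma chartMap_zero {N N' : Type} [AddCommGroup N] [AddCommGroup N']
    {σ : PointedCone ℝ (RealSpace N)}
    (h : MapsInto (0 : N →+ N') σ (⊥ : PointedCone ℝ (RealSpace N'))) :
    chartMap 0 h = chartStr σ ≫ torusOne N' := by
  unfold torusOne chartStr chartMap
  rw [← Spec.map_comp, ← CommRingCat.ofHom_comp]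
  congr 2
  refine AddMonoidAlgebra.ringHom_ext (fun r => ?_) fun m => ?_
  · simp
  · have : dualMonoidMap 0 h m = 0 := by
      apply Subtype.ext
      ext x
      simp [dualMonoidMap]
    simp [this, ← AddMonoidAlgebra.one_def]

namespace Fan

variable {NF NX NB : Type} [AddCommGroup NF] [AddCommGroup NX] [AddCommGroup NB]
  [Module.Free ℤ NF] [Module.Finite ℤ NF] [Module.Free ℤ NX] [Module.Finite ℤ NX]
  [Module.Free ℤ NB] [Module.Finite ℤ NB] {FF : Fan NF} {FX : Fan NX} {FB : Fan NB}

/-- A lattice isomorphism over `N_B` that carries the cones over `τ` onto the product cones of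
`Σ_F` and the faces of `τ` induces an isomorphism `π⁻¹(U_τ) ≅ F × U_τ`: both sides are the toric
variety of the cones over `τ`. -/
theorem exists_iso_of_product {φ : NX →+ NF} {π' : NX →+ NB} (hπ : IsFanMap π' FX FB)
    {τ : PointedCone ℝ (RealSpace NB)} (hτ : τ ∈ FB.cones) (ψ : NX ≃+ NF × NB)
    (e₁ : φ = (AddMonoidHom.fst NF NB).comp ψ.toAddMonoidHom)
    (e₂ : π' = (AddMonoidHom.snd NF NB).comp ψ.toAddMonoidHom)
    (hφ : IsFanMap φ (FX.preimage π' τ) FF)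
    (hprod : ∀ κ ∈ FF.cones, κ.comap (realMap φ) ⊓ τ.comap (realMap π') ∈ FX.cones) :
    ∃ e : pullback (toricMap hπ) (FB.ι hτ) ≅ pullback FF.str (chartStr τ),
      e.hom ≫ pullback.snd FF.str (chartStr τ) = pullback.snd (toricMap hπ) (FB.ι hτ) ∧
      ∀ σ (hσ : σ ∈ FX.cones) (hστ : MapsInto π' σ τ) κ (hκ : κ ∈ FF.cones)
        (hσκ : MapsInto φ σ κ),
        pullback.lift (FX.ι hσ) (chartMap π' hστ) (ι_toricMap hπ hσ hτ hστ) ≫ e.hom ≫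
            pullback.fst FF.str (chartStr τ) = chartMap φ hσκ ≫ FF.ι hκ := by
  have hX := isPullback_preimage hπ hτ
  have hF := isPullback_prod ψ e₁ e₂ hφ (FX.mapsInto_of_mem_preimage π' τ)
    fun κ hκ => ⟨hprod κ hκ, fun x hx => hx.2⟩
  refine ⟨hX.isoPullback.symm ≪≫ hF.isoPullback, by simp, fun σ hσ hστ κ hκ hσκ => ?_⟩
  have hσ' : σ ∈ (FX.preimage π' τ).cones := ⟨hσ, hστ⟩
  have hl : pullback.lift (FX.ι hσ) (chartMap π' hστ) (ι_toricMap hπ hσ hτ hστ) =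
      (FX.preimage π' τ).ι hσ' ≫ hX.isoPullback.hom := by
    refine pullback.hom_ext ?_ ?_
    · rw [pullback.lift_fst, Category.assoc, IsPullback.isoPullback_hom_fst,
        ι_toricMap _ hσ' hσ (MapsInto.of_le le_rfl), chartMap_id, Category.id_comp]
    · rw [pullback.lift_snd, Category.assoc, IsPullback.isoPullback_hom_snd, ι_toChart]
  rw [hl]
  simp [ι_toricMap hφ hσ' hκ hσκ]

/-- The fiber of `π` over the identity element of the torus of `B` is already the fiber of the
product `π⁻¹(U_0) ≅ F × U_0`, that is, a section of its first projection. -/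
theorem isPullback_fiber {i' : NF →+ NX} {φ : NX →+ NF} {π' : NX →+ NB} (hi : IsFanMap i' FF FX)
    (hπ : IsFanMap π' FX FB) (ψ : NX ≃+ NF × NB)
    (e₁ : φ = (AddMonoidHom.fst NF NB).comp ψ.toAddMonoidHom)
    (e₂ : π' = (AddMonoidHom.snd NF NB).comp ψ.toAddMonoidHom)
    (hφ : IsFanMap φ (FX.preimage π' ⊥) FF)
    (hprod : ∀ κ ∈ FF.cones, κ.comap (realMap φ) ⊓
      (⊥ : PointedCone ℝ (RealSpace NB)).comap (realMap π') ∈ FX.cones)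
    (hφi : φ.comp i' = AddMonoidHom.id NF) (hπi : π'.comp i' = 0) :
    IsPullback (toricMap hi) FF.str (toricMap hπ) FB.onePoint := by
  have hX := isPullback_preimage hπ FB.bot_mem
  have hF := isPullback_prod ψ e₁ e₂ hφ (FX.mapsInto_of_mem_preimage π' ⊥)
    fun κ hκ => ⟨hprod κ hκ, fun x hx => hx.2⟩
  have hiπ : ∀ x, realMap π' (realMap i' x) = 0 := fun x => by
    rw [← realMap_comp, hπi, realMap_zero]
  have hi' : IsFanMap i' FF (FX.preimage π' ⊥) := fun σ hσ => by
    obtain ⟨σ', hσ', h⟩ := hi σ hσ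
    exact ⟨_, ⟨inf_comap_mem hπ hσ' FB.bot_mem, mapsInto_inf_comap π' σ' ⊥⟩,
      fun x hx => ⟨h x hx, hiπ x⟩⟩
  have hcomp : toricMap hi' ≫ toricMap hφ = 𝟙 _ := by
    have hid : IsFanMap (φ.comp i') FF FF := by
      rw [hφi]; exact fun σ hσ => ⟨σ, hσ, MapsInto.of_le le_rfl⟩
    rw [toricMap_comp hi' hφ hid]
    revert hid
    rw [hφi]
    exact toricMap_id
  have hsq : toricMap hi' ≫ toChart (FX.mapsInto_of_mem_preimage π' ⊥) =
      FF.str ≫ torusOne NB := by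
    refine FF.hom_ext fun σ hσ => ?_
    obtain ⟨σ', hσ', h⟩ := hi' σ hσ
    have h0 : MapsInto (0 : NF →+ NB) σ ⊥ := fun x _ => by
      rw [realMap_zero]; exact zero_mem _
    rw [← Category.assoc, ι_toricMap hi' hσ hσ' h, Category.assoc, ι_toChart, chartMap_comp,
      ← Category.assoc, ι_str, ← chartMap_zero h0]
    exact chartMap_congr hπi _ _
  have hfib : IsPullback (toricMap hi') FF.str (toChart (FX.mapsInto_of_mem_preimage π' ⊥))
      (torusOne NB) := by
    refine IsPullback.of_right ?_ hsq hF
    rw [hcomp, torusOne_str]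
    exact IsPullback.of_horiz_isIso ⟨by simp⟩
  have := hfib.paste_horiz hX
  rwa [toricMap_comp hi' (FX.isFanMap_preimage π' ⊥) (by rwa [AddMonoidHom.id_comp])] at this

end Fan

/-! ### The fan of the bundle -/

lemma mapsInto_spannedCone {N N' : Type} [AddCommGroup N] [AddCommGroup N'] {φ : N →+ N'}
    {S : Set N} {σ : PointedCone ℝ (RealSpace N')} (h : ∀ v ∈ S, (1 : ℝ) ⊗ₜ[ℤ] φ v ∈ σ) :
    MapsInto φ (spannedCone S) σ := fun x hx => by
  refine spannedCone_induction (p := fun x => realMap φ x ∈ σ) (fun v hv => ?_) ?_ ?_ ?_ hx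
  · rw [realMap_tmul]; exact h v hv
  · rw [map_zero]; exact zero_mem _
  · intro x y _ _ hx hy; rw [map_add]; exact add_mem hx hy
  · intro a x ha _ hx
    rw [map_smul]; exact Submodule.smul_mem σ (⟨a, ha⟩ : {c : ℝ // 0 ≤ c}) hx

/-- The rank of `N` is the dimension of `N_ℝ`, so a fan is full if every cone lies in a cone that
spans `N_ℝ`. -/
lemma Fan.isFull_of_span_eq_top {N : Type} [AddCommGroup N] [Module.Free ℤ N] [Module.Finite ℤ N]
    {F : Fan N} (h : ∀ σ ∈ F.cones, ∃ τ ∈ F.cones, σ ≤ τ ∧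
      Submodule.span ℝ (τ : Set (RealSpace N)) = ⊤) : F.IsFull := fun σ hσ hmax => by
  obtain ⟨τ, hτ, hle, htop⟩ := h σ hσ
  rw [← hmax τ hτ hle, htop, finrank_top]
  exact Module.finrank_baseChange

lemma tmul_eq_sum {I N : Type} [Fintype I] [DecidableEq I] [AddCommGroup N] (f : (I → ℤ) →+ N)
    (c : I → ℤ) : (1 : ℝ) ⊗ₜ[ℤ] f c = ∑ i, (c i : ℝ) • ((1 : ℝ) ⊗ₜ[ℤ] f (Pi.single i 1)) := by
  have hc : c = ∑ i, c i • Pi.single i (1 : ℤ) := by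
    ext j; simp [Finset.sum_apply, Pi.single_apply]
  conv_lhs => rw [hc, map_sum, TensorProduct.tmul_sum]
  refine Finset.sum_congr rfl fun i _ => ?_
  rw [map_zsmul, TensorProduct.tmul_smul, TensorProduct.smul_tmul', TensorProduct.smul_tmul',
    zsmul_eq_mul, smul_eq_mul]

lemma span_eq_top_of_surjective {I N : Type} [Fintype I] [DecidableEq I] [AddCommGroup N]
    {f : (I → ℤ) →+ N} (hf : Function.Surjective f) {W : Submodule ℝ (RealSpace N)}
    (h : ∀ i, (1 : ℝ) ⊗ₜ[ℤ] f (Pi.single i 1) ∈ W) : W = ⊤ := by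
  rw [eq_top_iff]
  rintro x -
  induction x using TensorProduct.induction_on with
  | zero => exact zero_mem _
  | add x y hx hy => exact add_mem hx hy
  | tmul r v =>
    obtain ⟨v, rfl⟩ := hf v
    rw [← mul_one r, ← smul_eq_mul, ← TensorProduct.smul_tmul', tmul_eq_sum]
    exact W.smul_mem _ (sum_mem fun i _ => W.smul_mem _ (h i))

/-- A vector that occurs in a linear relation between the images of the standard basis vectors lies
in every subspace that contains the other ones. -/
lemma tmul_mem_of_relation {I N : Type} [Fintype I] [DecidableEq I] [AddCommGroup N]
    {f : (I → ℤ) →+ N} {c : I → ℤ} (hc : f c = 0) {j : I} (hj : c j ≠ 0)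
    {W : Submodule ℝ (RealSpace N)}
    (h : ∀ i, i ≠ j → c i ≠ 0 → (1 : ℝ) ⊗ₜ[ℤ] f (Pi.single i 1) ∈ W) :
    (1 : ℝ) ⊗ₜ[ℤ] f (Pi.single j 1) ∈ W := by
  have hs := tmul_eq_sum f c
  rw [hc, TensorProduct.tmul_zero, ← Finset.add_sum_erase _ _ (Finset.mem_univ j)] at hs
  have hj' : (c j : ℝ) ≠ 0 := by exact_mod_cast hj
  rw [← W.smul_mem_iff hj', eq_neg_of_add_eq_zero_left hs.symm]
  refine neg_mem (sum_mem fun i hi => ?_)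
  by_cases h0 : c i = 0
  · rw [h0]; simp
  · exact W.smul_mem _ (h i (Finset.ne_of_mem_erase hi) h0)

lemma tmul_mem_span {I N : Type} [AddCommGroup N] {v : I → N} {S : Set I} {i : I} (hi : i ∈ S) :
    (1 : ℝ) ⊗ₜ[ℤ] v i ∈
      Submodule.span ℝ (spannedCone (v '' S) : Set (RealSpace N)) :=
  Submodule.subset_span (mem_spannedCone ⟨i, hi, rfl⟩)

variable {n : ℕ}

/-- The relation `∑ a_i e_i = 0` expresses any `e_j` through the other ones, because `a_j ≠ 0`. -/
lemma wpsFan_isFull (w : Weights n) : (wpsFan w).IsFull := by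
  refine Fan.isFull_of_span_eq_top ?_
  rintro _ ⟨S, hS, rfl⟩
  obtain ⟨j, hj⟩ := (Set.ne_univ_iff_exists_notMem S).1 hS
  refine ⟨_, wpsCone_compl_mem w j, spannedCone_mono (Set.image_mono
    (Set.subset_compl_singleton_iff.2 hj)), ?_⟩
  have h : ∀ i, i ≠ j → (1 : ℝ) ⊗ₜ[ℤ] wpsMk w (Pi.single i 1) ∈
      Submodule.span ℝ (wpsCone w {j}ᶜ : Set (RealSpace (wpsLattice w))) := fun i hi =>
    tmul_mem_span (v := wpsVec w) (by simpa using hi)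
  refine span_eq_top_of_surjective (wpsMk_surjective w) fun i => ?_
  by_cases hi : i = j
  · subst hi
    exact tmul_mem_of_relation (c := fun i => (w.a i : ℤ))
      ((wpsMk_eq_zero w _).2 ⟨1, fun i => (one_mul _).symm⟩)
      (by exact_mod_cast (w.pos i).ne') fun l hl _ => h l hl
  · exact h i hi

/-- A maximal cone omits one `e_i` and one `f_j`. The relation `∑ a_i e_i = 0` recovers the former,
and then the relation `∑ f_j = ∑ d_i e_i` recovers the latter. -/
lemma bundleFan_isFull (w : Weights n) (d : Fin (n + 1) → ℤ) (k : ℕ) :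
    (bundleFan w d k).IsFull := by
  refine Fan.isFull_of_span_eq_top ?_
  rintro _ ⟨S, ⟨⟨i₀, hi₀⟩, j₀, hj₀⟩, rfl⟩
  let T : Set (Fin (n + 1) ⊕ Fin (k + 1)) := {Sum.inl i₀, Sum.inr j₀}ᶜ
  refine ⟨bundleCone w d k T, ⟨T, ⟨⟨i₀, by simp [T]⟩, j₀, by simp [T]⟩, rfl⟩,
    spannedCone_mono (Set.image_mono fun x hx => ?_), ?_⟩
  · rintro (rfl | rfl)
    exacts [hi₀ hx, hj₀ hx]
  have h : ∀ i, i ≠ Sum.inl i₀ → i ≠ Sum.inr j₀ →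
      (1 : ℝ) ⊗ₜ[ℤ] bundleMk w d k (Pi.single i 1) ∈
        Submodule.span ℝ (bundleCone w d k T : Set (RealSpace (bundleLattice w d k))) :=
    fun i hi hi' => tmul_mem_span (v := bundleVec w d k) (by simp [T, hi, hi'])
  have hl : ∀ i, (1 : ℝ) ⊗ₜ[ℤ] bundleMk w d k (Pi.single (Sum.inl i) 1) ∈
      Submodule.span ℝ (bundleCone w d k T : Set (RealSpace (bundleLattice w d k))) := fun i => by
    by_cases hi : i = i₀
    · subst hi
      refine tmul_mem_of_relation (c := Sum.elim (fun i => (w.a i : ℤ)) 0)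
        ((bundleMk_eq_zero w d k _).2 ⟨1, 0, fun i => by simp, fun j => rfl⟩)
        (by simpa using (w.pos i).ne') ?_
      rintro (l | l) hl hc
      · exact h _ hl (by simp)
      · exact absurd rfl hc
    · exact h _ (by simpa using hi) (by simp)
  refine span_eq_top_of_surjective (bundleMk_surjective w d k) ?_
  rintro (i | j)
  · exact hl i
  · by_cases hj : j = j₀
    · subst hj
      refine tmul_mem_of_relation (c := Sum.elim (fun i => -d i) 1)
        ((bundleMk_eq_zero w d k _).2 ⟨0, 1, fun i => by simp, fun j => rfl⟩) (by simp) ?_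
      rintro (l | l) hl' -
      · exact hl l
      · exact h _ (by simp) hl'
    · exact h _ (by simp) (by simpa using hj)

lemma bundleIncl_vec (w : Weights n) (d : Fin (n + 1) → ℤ) (k : ℕ) (i : Fin (n + 1)) :
    bundleIncl w d k (wpsVec w i) = bundleVec w d k (Sum.inl i) := by
  refine congrArg (bundleMk w d k) ?_
  ext (l | l) <;> simp [Pi.single_apply]

lemma bundleProj_mk (w : Weights n) (d : Fin (n + 1) → ℤ) {k : ℕ} (hk : 0 < k)
    (v : Fin (n + 1) ⊕ Fin (k + 1) → ℤ) : bundleProj w d k hk (bundleMk w d k v) =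
      wpsMk (Weights.one k hk) fun j => v (Sum.inr j) := rfl

lemma bundleProj_inl (w : Weights n) (d : Fin (n + 1) → ℤ) {k : ℕ} (hk : 0 < k)
    (i : Fin (n + 1)) : bundleProj w d k hk (bundleVec w d k (Sum.inl i)) = 0 := by
  rw [bundleVec, bundleProj_mk, ← map_zero (wpsMk (Weights.one k hk))]
  congr 1

lemma bundleProj_inr (w : Weights n) (d : Fin (n + 1) → ℤ) {k : ℕ} (hk : 0 < k)
    (j : Fin (k + 1)) : bundleProj w d k hk (bundleVec w d k (Sum.inr j)) =
      wpsVec (Weights.one k hk) j := by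
  rw [bundleVec, bundleProj_mk, wpsVec]
  congr 1
  ext l; simp [Pi.single_apply]

lemma isFanMap_bundleIncl (w : Weights n) (d : Fin (n + 1) → ℤ) (k : ℕ) :
    IsFanMap (bundleIncl w d k) (wpsFan w) (bundleFan w d k) := by
  rintro _ ⟨S, hS, rfl⟩
  obtain ⟨i, hi⟩ := (Set.ne_univ_iff_exists_notMem S).1 hS
  refine ⟨_, ⟨Sum.inl '' S, ⟨⟨i, by simpa using hi⟩, 0, by simp⟩, rfl⟩, mapsInto_spannedCone ?_⟩
  rintro _ ⟨l, hl, rfl⟩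
  rw [bundleIncl_vec]
  exact mem_spannedCone ⟨_, ⟨l, hl, rfl⟩, rfl⟩

lemma mapsInto_bundleProj (w : Weights n) (d : Fin (n + 1) → ℤ) {k : ℕ} (hk : 0 < k)
    (S : Set (Fin (n + 1) ⊕ Fin (k + 1))) :
    MapsInto (bundleProj w d k hk) (bundleCone w d k S)
      (wpsCone (Weights.one k hk) (Sum.inr ⁻¹' S)) := by
  refine mapsInto_spannedCone ?_
  rintro _ ⟨l | l, hl, rfl⟩
  · rw [bundleProj_inl, TensorProduct.tmul_zero]; exact zero_mem _
  · rw [bundleProj_inr]; exact mem_spannedCone ⟨l, hl, rfl⟩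

lemma isFanMap_bundleProj (w : Weights n) (d : Fin (n + 1) → ℤ) {k : ℕ} (hk : 0 < k) :
    IsFanMap (bundleProj w d k hk) (bundleFan w d k) (wpsFan (Weights.one k hk)) := by
  rintro _ ⟨S, ⟨-, j, hj⟩, rfl⟩
  exact ⟨_, ⟨Sum.inr ⁻¹' S, (Set.ne_univ_iff_exists_notMem _).2 ⟨j, hj⟩, rfl⟩,
    mapsInto_bundleProj w d hk S⟩

/-- The generators of a cone of the fan of a weighted projective space are the only images of
standard basis vectors in it. -/
lemma mem_of_wpsVec_mem {w : Weights n} (hn : 0 < n) {S : Set (Fin (n + 1))} (hS : S ≠ Set.univ)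
    {j : Fin (n + 1)} (h : (1 : ℝ) ⊗ₜ[ℤ] wpsVec w j ∈ wpsCone w S) : j ∈ S := by
  by_contra hj
  have : Nontrivial (Fin (n + 1)) := Fin.nontrivial_iff_two_le.2 (by omega)
  obtain ⟨l, hl⟩ := exists_ne j
  have hT : ({j} : Set (Fin (n + 1))) ≠ Set.univ :=
    (Set.ne_univ_iff_exists_notMem _).2 ⟨l, hl⟩
  obtain ⟨y, h₁, h₂, -, h₄⟩ := exists_weighted_signs w hS hT
  let m : wpsLattice w →+ ℤ := QuotientAddGroup.lift _ (dotHom y) (by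
    rw [AddSubgroup.zmultiples_le]
    exact h₄)
  have hm : ∀ i, m (wpsVec w i) = y i := fun i => dotHom_single y i
  have h₅ := (spannedCone_face (m := m) (v := wpsVec w) (S := S) (fun i hi => by
    rw [hm]; exact (h₁ i hi fun hij => hj (by rwa [← Set.mem_singleton_iff.1 hij])).le) h).1
  rw [pairing_tmul, one_mul, hm] at h₅
  have h₆ : 0 ≤ y j := by exact_mod_cast h₅
  exact (h₂ j rfl hj).not_ge h₆

/-- A cone of the bundle lies over the cone spanned by the `f_l`, `l ∈ S`, only if its generators
among the `f_l` have `l ∈ S`. -/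
lemma preimage_subset_of_mapsInto {w : Weights n} {d : Fin (n + 1) → ℤ} {k : ℕ} {hk : 0 < k}
    {T : Set (Fin (n + 1) ⊕ Fin (k + 1))} {S : Set (Fin (k + 1))} (hS : S ≠ Set.univ)
    (h : MapsInto (bundleProj w d k hk) (bundleCone w d k T) (wpsCone (Weights.one k hk) S)) :
    Sum.inr ⁻¹' T ⊆ S := fun j hj => by
  have := h _ (mem_spannedCone ⟨_, hj, rfl⟩)
  rw [realMap_tmul, bundleProj_inr] at this
  exact mem_of_wpsVec_mem hk hS this

/-! ### The lattice trivializations -/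

lemma twistMatrix_mulVec_inl (d : Fin (n + 1) → ℤ) {k : ℕ} (j : Fin (k + 1))
    (v : Fin (n + 1) ⊕ Fin (k + 1) → ℤ) (i : Fin (n + 1)) :
    (twistMatrix d j).mulVec v (Sum.inl i) = v (Sum.inl i) + d i * v (Sum.inr j) := by
  simp [twistMatrix, Matrix.mulVec, dotProduct, Matrix.one_apply]

lemma twistMatrix_mulVec_inr (d : Fin (n + 1) → ℤ) {k : ℕ} (j : Fin (k + 1))
    (v : Fin (n + 1) ⊕ Fin (k + 1) → ℤ) (l : Fin (k + 1)) :
    (twistMatrix d j).mulVec v (Sum.inr l) = v (Sum.inr l) := by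
  simp [twistMatrix, Matrix.mulVec, dotProduct, Matrix.one_apply]

/-- The homomorphism `N → N_a` induced by the first block row of the matrix `(I M_j; 0 I)`. It is
well defined: it sends `(-d, 1)`, where `1` stands for `(1, …, 1)`, to `-d + d = 0`. -/
def twistFst (w : Weights n) (d : Fin (n + 1) → ℤ) {k : ℕ} (j : Fin (k + 1)) :
    bundleLattice w d k →+ wpsLattice w :=
  QuotientAddGroup.lift _ ((wpsMk w).comp
    { toFun := fun v i => v (Sum.inl i) + d i * v (Sum.inr j)
      map_zero' := by ext; simp
      map_add' := fun x y => by ext; simp; ring }) (by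
    intro x hx
    obtain ⟨c, b, hc, hb⟩ := (mem_range_bundleMatrix w d k x).1 hx
    exact (wpsMk_eq_zero _ _).2 ⟨c, fun i => by simp [hc, hb]; ring⟩)

lemma twistFst_mk (w : Weights n) (d : Fin (n + 1) → ℤ) {k : ℕ} (j : Fin (k + 1))
    (v : Fin (n + 1) ⊕ Fin (k + 1) → ℤ) : twistFst w d j (bundleMk w d k v) =
      wpsMk w fun i => v (Sum.inl i) + d i * v (Sum.inr j) := rfl

/-- The isomorphism `ψ_j : N ≅ N_a ⊕ N_{ℙ^k}` induced by the matrix `(I M_j; 0 I)`. -/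
def twistEquiv (w : Weights n) (d : Fin (n + 1) → ℤ) {k : ℕ} (hk : 0 < k) (j : Fin (k + 1)) :
    bundleLattice w d k ≃+ wpsLattice w × wpsLattice (Weights.one k hk) :=
  AddEquiv.ofBijective ((twistFst w d j).prod (bundleProj w d k hk)) (by
    constructor
    · rw [injective_iff_map_eq_zero]
      intro x hx
      obtain ⟨v, rfl⟩ := bundleMk_surjective w d k x
      rw [AddMonoidHom.prod_apply, Prod.mk_eq_zero, twistFst_mk, bundleProj_mk, wpsMk_eq_zero,
        wpsMk_eq_zero] at hx
      obtain ⟨⟨c, hc⟩, b, hb⟩ := hx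
      have hb' : ∀ l, v (Sum.inr l) = b := fun l => by simpa [Weights.one] using hb l
      refine (bundleMk_eq_zero w d k v).2 ⟨c, b, fun i => ?_, hb'⟩
      rw [← hc i, hb']; ring
    · rintro ⟨x, y⟩
      obtain ⟨x, rfl⟩ := wpsMk_surjective w x
      obtain ⟨y, rfl⟩ := wpsMk_surjective (Weights.one k hk) y
      refine ⟨bundleMk w d k (Sum.elim (fun i => x i - d i * y j) y), ?_⟩
      rw [AddMonoidHom.prod_apply, twistFst_mk, bundleProj_mk]
      simp)

lemma fst_comp_twistEquiv (w : Weights n) (d : Fin (n + 1) → ℤ) {k : ℕ} (hk : 0 < k)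
    (j : Fin (k + 1)) : (AddMonoidHom.fst _ _).comp (twistEquiv w d hk j).toAddMonoidHom =
      twistFst w d j := rfl

lemma snd_comp_twistEquiv (w : Weights n) (d : Fin (n + 1) → ℤ) {k : ℕ} (hk : 0 < k)
    (j : Fin (k + 1)) : (AddMonoidHom.snd _ _).comp (twistEquiv w d hk j).toAddMonoidHom =
      bundleProj w d k hk := rfl

lemma twistFst_inl (w : Weights n) (d : Fin (n + 1) → ℤ) {k : ℕ} (j : Fin (k + 1))
    (i : Fin (n + 1)) : twistFst w d j (bundleVec w d k (Sum.inl i)) = wpsVec w i := by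
  rw [bundleVec, twistFst_mk, wpsVec]
  congr 1
  ext l; simp [Pi.single_apply]

lemma twistFst_inr (w : Weights n) (d : Fin (n + 1) → ℤ) {k : ℕ} {j l : Fin (k + 1)}
    (h : l ≠ j) : twistFst w d j (bundleVec w d k (Sum.inr l)) = 0 := by
  rw [bundleVec, twistFst_mk, ← map_zero (wpsMk w)]
  congr 1
  ext i; simp [h.symm]

/-- Under `ψ_j`, a cone of the bundle without the generator `f_j` is a product cone. -/
lemma bundleCone_eq (w : Weights n) (d : Fin (n + 1) → ℤ) {k : ℕ} (hk : 0 < k) {j : Fin (k + 1)}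
    {T : Set (Fin (n + 1) ⊕ Fin (k + 1))} (hj : Sum.inr j ∉ T) :
    bundleCone w d k T = (wpsCone w (Sum.inl ⁻¹' T)).comap (realMap (twistFst w d j)) ⊓
      (wpsCone (Weights.one k hk) (Sum.inr ⁻¹' T)).comap (realMap (bundleProj w d k hk)) := by
  let ψ := twistEquiv w d hk j
  let i₁ := ψ.symm.toAddMonoidHom.comp (AddMonoidHom.inl _ _)
  let i₂ := ψ.symm.toAddMonoidHom.comp (AddMonoidHom.inr _ _)
  have hne : ∀ l, Sum.inr l ∈ T → l ≠ j := fun l hl h => hj (h ▸ hl)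
  have hi₁ : ∀ i, i₁ (wpsVec w i) = bundleVec w d k (Sum.inl i) := fun i =>
    (AddEquiv.symm_apply_eq ψ).2 (Prod.ext (twistFst_inl w d j i).symm
      (bundleProj_inl w d hk i).symm)
  have hi₂ : ∀ l, l ≠ j → i₂ (wpsVec _ l) = bundleVec w d k (Sum.inr l) := fun l hl =>
    (AddEquiv.symm_apply_eq ψ).2 (Prod.ext (twistFst_inr w d hl).symm
      (bundleProj_inr w d hk l).symm)
  have h₁ : MapsInto i₁ (wpsCone w (Sum.inl ⁻¹' T)) (bundleCone w d k T) := by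
    refine mapsInto_spannedCone ?_
    rintro _ ⟨i, hi, rfl⟩
    rw [hi₁]
    exact mem_spannedCone ⟨_, hi, rfl⟩
  have h₂ : MapsInto i₂ (wpsCone (Weights.one k hk) (Sum.inr ⁻¹' T)) (bundleCone w d k T) := by
    refine mapsInto_spannedCone ?_
    rintro _ ⟨l, hl, rfl⟩
    rw [hi₂ l (hne l hl)]
    exact mem_spannedCone ⟨_, hl, rfl⟩
  have hsum : ∀ x, realMap i₁ (realMap (twistFst w d j) x) +
      realMap i₂ (realMap (bundleProj w d k hk) x) = x := fun x => by
    induction x using TensorProduct.induction_on with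
    | zero => simp
    | tmul r v =>
      rw [realMap_tmul, realMap_tmul, realMap_tmul, realMap_tmul, ← TensorProduct.tmul_add]
      congr 1
      change ψ.symm (twistFst w d j v, 0) + ψ.symm (0, bundleProj w d k hk v) = v
      rw [← map_add, Prod.mk_add_mk, add_zero, zero_add]
      exact ψ.symm_apply_apply v
    | add x y hx hy =>
      simp only [map_add]
      rw [add_add_add_comm, hx, hy]
  ext x
  constructor
  · refine fun hx => ⟨?_, mapsInto_bundleProj w d hk T x hx⟩
    refine mapsInto_spannedCone (φ := twistFst w d j) (σ := wpsCone w (Sum.inl ⁻¹' T)) ?_ x hx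
    rintro _ ⟨i | l, hi, rfl⟩
    · rw [twistFst_inl]; exact mem_spannedCone ⟨i, hi, rfl⟩
    · rw [twistFst_inr w d (hne l hi), TensorProduct.tmul_zero]; exact zero_mem _
  · rintro ⟨hx₁, hx₂⟩
    rw [← hsum x]
    exact add_mem (h₁ _ hx₁) (h₂ _ hx₂)

lemma inl_preimage_union {I J : Type} (A : Set I) (R : Set J) :
    Sum.inl ⁻¹' (Sum.inl '' A ∪ Sum.inr '' R) = A := by
  ext; simp

lemma inr_preimage_union {I J : Type} (A : Set I) (R : Set J) :
    Sum.inr ⁻¹' (Sum.inl '' A ∪ Sum.inr '' R) = R := by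
  ext; simp

lemma comap_inf_comap_eq (w : Weights n) (d : Fin (n + 1) → ℤ) {k : ℕ} (hk : 0 < k)
    {j : Fin (k + 1)} (A : Set (Fin (n + 1))) {R : Set (Fin (k + 1))} (hj : j ∉ R) :
    (wpsCone w A).comap (realMap (twistFst w d j)) ⊓
      (wpsCone (Weights.one k hk) R).comap (realMap (bundleProj w d k hk)) =
      bundleCone w d k (Sum.inl '' A ∪ Sum.inr '' R) := by
  rw [bundleCone_eq w d hk (j := j) (by simpa using hj), inl_preimage_union, inr_preimage_union]

lemma union_mem_bundleComplex {k : ℕ} {A : Set (Fin (n + 1))} {R : Set (Fin (k + 1))}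
    (hA : A ≠ Set.univ) {j : Fin (k + 1)} (hj : j ∉ R) :
    Sum.inl '' A ∪ Sum.inr '' R ∈ bundleComplex n k := by
  obtain ⟨i, hi⟩ := (Set.ne_univ_iff_exists_notMem A).1 hA
  exact ⟨⟨i, by simpa using hi⟩, j, by simpa using hj⟩

lemma ne_univ_of_notMem {I : Type} {S : Set I} {j : I} (hj : j ∉ S) : S ≠ Set.univ :=
  (Set.ne_univ_iff_exists_notMem S).2 ⟨j, hj⟩

/-- Every cone over a cone of `ℙ^k` without the generator `f_j` has a first component under `ψ_j`
in the fan of `ℙ(a_0, …, a_n)`. -/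
lemma isFanMap_twistFst (w : Weights n) (d : Fin (n + 1) → ℤ) {k : ℕ} (hk : 0 < k)
    {j : Fin (k + 1)} {R : Set (Fin (k + 1))} (hj : j ∉ R) :
    IsFanMap (twistFst w d j) ((bundleFan w d k).preimage (bundleProj w d k hk)
      (wpsCone (Weights.one k hk) R)) (wpsFan w) := by
  rintro _ ⟨⟨T, ⟨⟨i, hi⟩, -⟩, rfl⟩, hT⟩
  have hjT : Sum.inr j ∉ T := fun h => hj (preimage_subset_of_mapsInto (ne_univ_of_notMem hj) hT h)
  refine ⟨_, ⟨Sum.inl ⁻¹' T, ne_univ_of_notMem hi, rfl⟩, fun x hx => ?_⟩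
  have hx' : x ∈ bundleCone w d k T := hx
  rw [bundleCone_eq w d hk hjT] at hx'
  exact hx'.1

lemma comap_inf_comap_mem (w : Weights n) (d : Fin (n + 1) → ℤ) {k : ℕ} (hk : 0 < k)
    {j : Fin (k + 1)} {R : Set (Fin (k + 1))} (hj : j ∉ R) :
    ∀ κ ∈ (wpsFan w).cones, κ.comap (realMap (twistFst w d j)) ⊓
      (wpsCone (Weights.one k hk) R).comap (realMap (bundleProj w d k hk)) ∈
        (bundleFan w d k).cones := by
  rintro _ ⟨A, hA, rfl⟩
  exact ⟨_, union_mem_bundleComplex hA hj, comap_inf_comap_eq w d hk A hj⟩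

lemma map_twistEquiv_bundleCone (w : Weights n) (d : Fin (n + 1) → ℤ) {k : ℕ} (hk : 0 < k)
    {j : Fin (k + 1)} {T : Set (Fin (n + 1) ⊕ Fin (k + 1))} (hj : Sum.inr j ∉ T) :
    PointedCone.map (realMap (twistEquiv w d hk j).toAddMonoidHom) (bundleCone w d k T) =
      prodCone (wpsCone w (Sum.inl ⁻¹' T)) (wpsCone (Weights.one k hk) (Sum.inr ⁻¹' T)) := by
  let ψ := twistEquiv w d hk j
  have hψ : ∀ y, realMap ψ.toAddMonoidHom (realMap ψ.symm.toAddMonoidHom y) = y := fun y => by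
    rw [← realMap_comp]
    convert realMap_id y
    ext x <;> simp
  have hiff : ∀ x, x ∈ bundleCone w d k T ↔ realMap ψ.toAddMonoidHom x ∈
      prodCone (wpsCone w (Sum.inl ⁻¹' T)) (wpsCone (Weights.one k hk) (Sum.inr ⁻¹' T)) :=
    fun x => by
      rw [bundleCone_eq w d hk hj, prodCone, Submodule.mem_inf, Submodule.mem_inf,
        PointedCone.mem_comap, PointedCone.mem_comap, PointedCone.mem_comap,
        PointedCone.mem_comap, ← realMap_comp, ← realMap_comp, fst_comp_twistEquiv,
        snd_comp_twistEquiv]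
  ext y
  rw [PointedCone.mem_map]
  constructor
  · rintro ⟨x, hx, rfl⟩
    exact (hiff x).1 hx
  · intro hy
    exact ⟨realMap ψ.symm.toAddMonoidHom y, (hiff _).2 (by rwa [hψ]), hψ y⟩

theorem isToricTrivialization_twistEquiv (w : Weights n) (d : Fin (n + 1) → ℤ) {k : ℕ}
    (hk : 0 < k) (j : Fin (k + 1)) :
    IsToricTrivialization (wpsFan w) (bundleFan w d k) (wpsFan (Weights.one k hk))
      (bundleProj w d k hk) (isFanMap_bundleProj w d hk)
      (wpsCone_compl_mem (Weights.one k hk) j) (twistEquiv w d hk j) where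
  snd_eq := rfl
  cones_eq := by
    have hj : j ∉ ({j}ᶜ : Set (Fin (k + 1))) := fun h => h rfl
    ext θ
    constructor
    · rintro ⟨_, ⟨⟨T, ⟨⟨i, hi⟩, -⟩, rfl⟩, hT⟩, rfl⟩
      have hsub := preimage_subset_of_mapsInto (ne_univ_of_notMem hj) hT
      have hjT : Sum.inr j ∉ T := fun h => hj (hsub h)
      exact ⟨_, ⟨Sum.inl ⁻¹' T, ne_univ_of_notMem hi, rfl⟩, _,
        ⟨Sum.inr ⁻¹' T, ne_univ_of_notMem hjT, rfl⟩, spannedCone_mono (Set.image_mono hsub),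
        map_twistEquiv_bundleCone w d hk hjT⟩
    · rintro ⟨_, ⟨A, hA, rfl⟩, _, ⟨R, -, rfl⟩, hle, rfl⟩
      have hjR : j ∉ R := fun h => hj (mem_of_wpsVec_mem hk (ne_univ_of_notMem hj)
        (hle (mem_spannedCone ⟨j, h, rfl⟩)))
      have hT : Sum.inr j ∉ Sum.inl '' A ∪ Sum.inr '' R := by simpa using hjR
      refine ⟨bundleCone w d k (Sum.inl '' A ∪ Sum.inr '' R),
        ⟨⟨_, union_mem_bundleComplex hA hjR, rfl⟩, ?_⟩, ?_⟩
      · rw [← comap_inf_comap_eq w d hk A hjR]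
        exact fun x hx => hle hx.2
      · rw [map_twistEquiv_bundleCone w d hk hT, inl_preimage_union, inr_preimage_union]
        rfl
  exists_iso := Fan.exists_iso_of_product (isFanMap_bundleProj w d hk)
    (wpsCone_compl_mem (Weights.one k hk) j) (twistEquiv w d hk j) rfl rfl
    (isFanMap_twistFst w d hk fun h => h rfl) (comap_inf_comap_mem w d hk fun h => h rfl)

lemma wpsCone_empty (w : Weights n) : wpsCone w ∅ = ⊥ := by
  simp [wpsCone, spannedCone]

/-- Every cone of `ℙ^k` omits some generator `f_j`, so `ψ_j` trivializes the fibration over its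
chart. Over the zero cone every `ψ_j` does, and the fiber over the identity of the torus is read off from
`ψ_0`, for which `ψ_0 ∘ i' = (id, 0)`. -/
theorem isLocallyTrivialToricFibration_bundle (w : Weights n) (d : Fin (n + 1) → ℤ) {k : ℕ}
    (hk : 0 < k) : IsLocallyTrivialToricFibration (wpsFan w) (bundleFan w d k)
      (wpsFan (Weights.one k hk)) (bundleIncl w d k) (bundleProj w d k hk) where
  full_fiber := wpsFan_isFull w
  full_total := bundleFan_isFull w d k
  full_base := wpsFan_isFull _
  fanMap_incl := isFanMap_bundleIncl w d k
  fanMap_proj := isFanMap_bundleProj w d hk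
  isFiber := by
    have h0 : (0 : Fin (k + 1)) ∉ (∅ : Set (Fin (k + 1))) := Set.notMem_empty _
    have hφ := isFanMap_twistFst w d hk h0
    have hprod := comap_inf_comap_mem w d hk h0
    rw [wpsCone_empty] at hφ hprod
    refine Fan.isPullback_fiber _ _ (twistEquiv w d hk 0) rfl rfl hφ hprod ?_ ?_
    · ext x
      obtain ⟨x, rfl⟩ := wpsMk_surjective w x
      change wpsMk w (fun i => x i + d i * 0) = wpsMk w x
      simp
    · ext x
      obtain ⟨x, rfl⟩ := wpsMk_surjective w x
      exact map_zero (wpsMk (Weights.one k hk))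
  locallyTrivial := by
    rintro _ ⟨R, hR, rfl⟩
    obtain ⟨j, hj⟩ := (Set.ne_univ_iff_exists_notMem R).1 hR
    obtain ⟨e, he, -⟩ := Fan.exists_iso_of_product (isFanMap_bundleProj w d hk) ⟨R, hR, rfl⟩
      (twistEquiv w d hk j) rfl rfl (isFanMap_twistFst w d hk hj) (comap_inf_comap_mem w d hk hj)
    exact ⟨e, he⟩

end Toric

end

/-- The toric variety of the fan of the bundle construction is a locally trivial toric fibration over
`ℙ^k` with fiber `ℙ(a_0, …, a_n)`, and over each standard affine chart of `ℙ^k` it is trivialized by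
the lattice isomorphism that the block matrix `(I M; 0 I)` induces. -/
theorem propositionP (n k : ℕ) (hn : 0 < n) (hk : 0 < k) (w : Toric.Weights n)
    (d : Fin (n + 1) → ℤ) :
    ∃ h : Toric.IsLocallyTrivialToricFibration (Toric.wpsFan w) (Toric.bundleFan w d k)
        (Toric.wpsFan (Toric.Weights.one k hk)) (Toric.bundleIncl w d k)
        (Toric.bundleProj w d k hk),
      ∀ j : Fin (k + 1),
        ∃ ψ : Toric.bundleLattice w d k ≃+
            Toric.wpsLattice w × Toric.wpsLattice (Toric.Weights.one k hk),
          (∀ v : Fin (n + 1) ⊕ Fin (k + 1) → ℤ,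
            ψ (Toric.bundleMk w d k v) =
              (Toric.wpsMk w fun i => (Toric.twistMatrix d j).mulVec v (Sum.inl i),
                Toric.wpsMk (Toric.Weights.one k hk)
                  fun l => (Toric.twistMatrix d j).mulVec v (Sum.inr l))) ∧
          Toric.IsToricTrivialization (Toric.wpsFan w) (Toric.bundleFan w d k)
            (Toric.wpsFan (Toric.Weights.one k hk)) (Toric.bundleProj w d k hk) h.fanMap_proj
            (Toric.wpsCone_compl_mem (Toric.Weights.one k hk) j) ψ := by
  exact ⟨Toric.isLocallyTrivialToricFibration_bundle w d hk, fun j =>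
    ⟨Toric.twistEquiv w d hk j, fun v => by
      simp only [Toric.twistMatrix_mulVec_inl, Toric.twistMatrix_mulVec_inr]
      rfl, Toric.isToricTrivialization_twistEquiv w d hk j⟩⟩
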